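/- Let $2<p<\infty$. For $x\in\mathbb{R}^n$ and $1\le q<\infty$ write $|\!|\!|x|\!|\!|_q=\bigl(\frac1n\sum_{i=1}^n|x_i|^q\bigr)^{1/q}$. For each $n\ge 1$ let $G_n$ be an $n\times n$ random matrix whose entries are i.i.d. standard Gaussian random variables, with all the matrices $G_n$ defined on one common probability space (no assumption is made on the joint law of different $G_n$). For $u,t>0$ set $$L_{n,p,u}(t)=\max_{x\in\mathbb{R}^n:\,|\!|\!|x|\!|\!|_2^2=u}\Bigl(\frac{\langle G_nx,x\rangle}{n^{3/2}}-t\,|\!|\!|x|\!|\!|_p^p\Bigr),\qquad L_{n,p}(t)=\max_{x\in\mathbb{R}^n}\Bigl(\frac{\langle G_nx,x\rangle}{n^{3/2}}-t\,|\!|\!|x|\!|\!|_p^p\Bigr).$$ Then there are deterministic real numbers $L_{p,u}(t)$ and $L_p(t)$ ($u,t>0$), depending only on $p,u,t$ and on $p,t$ respectively, such that every $L_{n,p,u}(t)$ is integrable, $$\lim_{n\to\infty}\mathbb{E}L_{n,p,u}(t)=L_{p,u}(t)\quad\text{for all }u,t>0,\qquad L_p(t)=\sup_{u>0}L_{p,u}(t)\quad\text{for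 all }t>0,$$ and, almost surely, $$\lim_{n\to\infty}L_{n,p,u}(t)=L_{p,u}(t)\ \text{ for all }u,t>0\text{ simultaneously},\qquad \lim_{n\to\infty}L_{n,p}(t)=L_p(t)\ \text{ for all }t>0\text{ simultaneously}.$$ -/

import Mathlib

open MeasureTheory ProbabilityTheory Filter Topology Matrix

noncomputable section

/-- The normalized `ℓ_p`-norm `(n⁻¹ ∑ᵢ |xᵢ|^p)^{1/p}` of a vector `x ∈ ℝⁿ`, for finite `p`. -/
def normalizedNorm {n : ℕ} (p : ℝ) (x : Fin n → ℝ) : ℝ :=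
  ((1 / (n : ℝ)) * ∑ i, |x i| ^ p) ^ (1 / p)

/-- The penalized energy `⟨A x, x⟩ / n^{3/2} - t ‖x‖_p^p`, with the normalized `ℓ_p`-norm. -/
def penalizedEnergy {n : ℕ} (p t : ℝ) (A : Matrix (Fin n) (Fin n) ℝ) (x : Fin n → ℝ) : ℝ :=
  ((A *ᵥ x) ⬝ᵥ x) / (n : ℝ) ^ (3 / 2 : ℝ) - t * normalizedNorm p x ^ p

/-- The maximum of the penalized energy over all `x ∈ ℝⁿ`. -/
def groundStateEnergy {n : ℕ} (p t : ℝ) (A : Matrix (Fin n) (Fin n) ℝ) : ℝ :=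
  sSup (Set.range (penalizedEnergy p t A))

/-- The maximum of the penalized energy over all `x ∈ ℝⁿ` with self-overlap `‖x‖₂² = u`,
for the normalized `ℓ_2`-norm. -/
def constrainedGroundStateEnergy {n : ℕ} (p u t : ℝ) (A : Matrix (Fin n) (Fin n) ℝ) : ℝ :=
  sSup (penalizedEnergy p t A '' {x | normalizedNorm 2 x ^ 2 = u})

/-- `G` is an `n × n` random matrix on `(Ω, P)` with i.i.d. standard Gaussian entries. -/
structure IsGaussianMatrix {Ω : Type*} [MeasurableSpace Ω] (P : Measure Ω) {n : ℕ}
    (G : Ω → Matrix (Fin n) (Fin n) ℝ) : Prop where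
  indep : iIndepFun (fun (ij : Fin n × Fin n) ω => G ω ij.1 ij.2) P
  law : ∀ i j, HasLaw (fun ω => G ω i j) (gaussianReal 0 1) P

lemma normalizedNorm_rpow {n : ℕ} {p : ℝ} (hp : 0 < p) (x : Fin n → ℝ) :
    normalizedNorm p x ^ p = (1 / (n : ℝ)) * ∑ i, |x i| ^ p := by
  unfold normalizedNorm
  rw [← Real.rpow_mul (by positivity), one_div_mul_cancel hp.ne', Real.rpow_one]

lemma normalizedNorm_two_sq {n : ℕ} (x : Fin n → ℝ) :
    normalizedNorm 2 x ^ 2 = (1 / (n : ℝ)) * ∑ i, x i ^ 2 := by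
  have h := normalizedNorm_rpow (n := n) (p := 2) (by norm_num) x
  simpa using h

lemma continuous_penalizedEnergy {n : ℕ} {p : ℝ} (hp : 0 < p) (t : ℝ)
    (A : Matrix (Fin n) (Fin n) ℝ) : Continuous (penalizedEnergy p t A) := by
  unfold penalizedEnergy
  simp only [normalizedNorm_rpow hp, Matrix.mulVec, dotProduct]
  refine Continuous.sub (Continuous.div_const (by fun_prop) _) ?_
  refine continuous_const.mul (continuous_const.mul ?_)
  exact continuous_finsetSum _ fun i _ =>
    (continuous_apply i).abs.rpow_const fun _ => Or.inr hp.le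

/-- The supremum in the definition of `constrainedGroundStateEnergy` is an attained maximum. -/
lemma isGreatest_constrainedGroundStateEnergy {n : ℕ} (hn : 0 < n) {p : ℝ} (hp : 2 < p)
    {u : ℝ} (hu : 0 < u) (t : ℝ) (A : Matrix (Fin n) (Fin n) ℝ) :
    IsGreatest (penalizedEnergy p t A '' {x | normalizedNorm 2 x ^ 2 = u})
      (constrainedGroundStateEnergy p u t A) := by
  have hn' : (0 : ℝ) < n := by exact_mod_cast hn
  have hS : {x : Fin n → ℝ | normalizedNorm 2 x ^ 2 = u}
      = {x : Fin n → ℝ | (1 / (n : ℝ)) * ∑ i, x i ^ 2 = u} := by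
    ext x; simp only [Set.mem_ofPred_eq, normalizedNorm_two_sq]
  have hc : IsCompact {x : Fin n → ℝ | normalizedNorm 2 x ^ 2 = u} := by
    rw [hS]
    refine Metric.isCompact_of_isClosed_isBounded
      (isClosed_eq (by fun_prop) continuous_const) ?_
    refine (Metric.isBounded_closedBall (x := 0) (r := Real.sqrt (n * u))).subset ?_
    intro x hx
    rw [mem_closedBall_zero_iff, pi_norm_le_iff_of_nonneg (Real.sqrt_nonneg _)]
    intro i
    rw [Real.norm_eq_abs]
    apply Real.abs_le_sqrt
    have h1 : x i ^ 2 ≤ ∑ j, x j ^ 2 :=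
      Finset.single_le_sum (f := fun j => x j ^ 2) (fun j _ => sq_nonneg _) (Finset.mem_univ i)
    have h2 : ∑ j, x j ^ 2 = n * u := by
      rw [← Set.mem_ofPred_eq.mp hx]; field_simp
    linarith
  have hne : {x : Fin n → ℝ | normalizedNorm 2 x ^ 2 = u}.Nonempty := by
    rw [hS]
    refine ⟨fun _ => Real.sqrt u, ?_⟩
    simp [Real.sq_sqrt hu.le]
    field_simp
  exact (hc.image (continuous_penalizedEnergy (by linarith) t A)).isGreatest_sSup (hne.image _)

/-- The supremum in the definition of `groundStateEnergy` is an attained maximum. -/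
lemma isGreatest_groundStateEnergy {n : ℕ} (hn : 0 < n) {p : ℝ} (hp : 2 < p)
    {t : ℝ} (ht : 0 < t) (A : Matrix (Fin n) (Fin n) ℝ) :
    IsGreatest (Set.range (penalizedEnergy p t A)) (groundStateEnergy p t A) := by
  have hn' : (0 : ℝ) < n := by exact_mod_cast hn
  have : Nonempty (Fin n) := ⟨⟨0, hn⟩⟩
  have hp0 : 0 < p := by linarith
  have h0 : penalizedEnergy p t A 0 = 0 := by
    simp [penalizedEnergy, normalizedNorm_rpow hp0, Real.zero_rpow hp0.ne']
  set K : ℝ := (∑ i, ∑ j, |A i j|) / (n : ℝ) ^ (3 / 2 : ℝ) with hK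
  have hbound : ∀ x : Fin n → ℝ,
      penalizedEnergy p t A x ≤ K * ‖x‖ ^ 2 - t / n * ‖x‖ ^ p := by
    intro x
    unfold penalizedEnergy
    rw [normalizedNorm_rpow hp0]
    have hq : (A *ᵥ x) ⬝ᵥ x ≤ (∑ i, ∑ j, |A i j|) * ‖x‖ ^ 2 := by
      simp only [Matrix.mulVec, dotProduct, Finset.sum_mul]
      refine Finset.sum_le_sum fun i _ => Finset.sum_le_sum fun j _ => ?_
      have hi := norm_le_pi_norm x i
      have hj := norm_le_pi_norm x j
      rw [Real.norm_eq_abs] at hi hj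
      calc A i j * x j * x i ≤ |A i j * x j * x i| := le_abs_self _
        _ = |A i j| * (|x j| * |x i|) := by rw [abs_mul, abs_mul]; ring
        _ ≤ |A i j| * (‖x‖ * ‖x‖) := by gcongr
        _ = _ := by ring
    have hs : ‖x‖ ^ p ≤ ∑ i, |x i| ^ p := by
      obtain ⟨i, hi⟩ := Finite.exists_max (fun i => |x i|)
      have hi' : ‖x‖ ≤ |x i| := (pi_norm_le_iff_of_nonneg (abs_nonneg _)).2 hi
      refine (Real.rpow_le_rpow (norm_nonneg _) hi' hp0.le).trans ?_
      exact Finset.single_le_sum (f := fun j => |x j| ^ p)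
        (fun j _ => by positivity) (Finset.mem_univ i)
    have e1 : ((A *ᵥ x) ⬝ᵥ x) / (n : ℝ) ^ (3 / 2 : ℝ) ≤ K * ‖x‖ ^ 2 := by
      rw [hK, div_mul_eq_mul_div]; gcongr
    have e2 : t / n * ‖x‖ ^ p ≤ t * (1 / (n : ℝ) * ∑ i, |x i| ^ p) := by
      calc t / n * ‖x‖ ^ p ≤ t / n * ∑ i, |x i| ^ p := by gcongr
        _ = _ := by ring
    linarith
  have hev : ∀ᶠ x in cocompact (Fin n → ℝ), penalizedEnergy p t A x ≤ penalizedEnergy p t A 0 := by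
    have hlim := (tendsto_rpow_atTop (show (0 : ℝ) < p - 2 by linarith)).comp
      (tendsto_norm_cocompact_atTop (E := Fin n → ℝ))
    filter_upwards [hlim.eventually_ge_atTop (K * n / t),
      (tendsto_norm_cocompact_atTop (E := Fin n → ℝ)).eventually_gt_atTop 0] with x hx hx0
    rw [h0]
    refine (hbound x).trans ?_
    have e : ‖x‖ ^ p = ‖x‖ ^ 2 * ‖x‖ ^ (p - 2) := by
      rw [← Real.rpow_natCast, ← Real.rpow_add hx0]; norm_num
    have hx' : K ≤ t / n * ‖x‖ ^ (p - 2) := by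
      have := (div_le_iff₀ ht).mp hx
      rw [div_mul_eq_mul_div, le_div_iff₀ hn']
      simp only [Function.comp] at this
      linarith
    rw [e]
    nlinarith [sq_nonneg ‖x‖, mul_le_mul_of_nonneg_right hx' (sq_nonneg ‖x‖)]
  obtain ⟨x, hx⟩ := (continuous_penalizedEnergy hp0 t A).exists_forall_ge' 0 hev
  have hg : IsGreatest (Set.range (penalizedEnergy p t A)) (penalizedEnergy p t A x) :=
    ⟨⟨x, rfl⟩, by rintro _ ⟨y, rfl⟩; exact hx y⟩
  rw [groundStateEnergy, hg.csSup_eq]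
  exact hg

end

/-! Why the theorem holds. Scaling x by √u gives L_{n,p,u}(t) = u · L_{n,p,1}(t u^{p/2-1}) for each
realisation of the matrix (`constrainedGroundStateEnergy_eq_mul`). Everything therefore reduces to
the sphere |x|² = n, where the energy is an affine function of the Gaussian matrix and its maximum
can be taken over a dense sequence.

Convergence of the mean. Let E_n(s) be the mean of L_{n,p,1}(s). The sequence n E_n(s) is
superadditive (`mul_meanGroundState_add_le`): the product of the spheres for m and k lies in the
sphere for m + k, the penalty is additive over blocks, and by convexity of r² the increments of two
independent block processes are dominated by those of the full process, so Sudakov–Fernique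
(`integral_supAffine_le_of_norm_sub_le`) compares the expected suprema. Comparison with a linear
process bounds E_n(s) by √2 for s ≥ 0 (`meanGroundState_le`), and Fekete's lemma gives the limit.
Sudakov–Fernique itself is proved by interpolating log-sum-exp along a rotation and integrating by
parts.

Almost sure convergence. Rotating an independent copy into the original bounds the centred fourth
moment by a constant times n^{-2} (`lintegral_unitGroundState_sub_mean_pow_four_le`). This is
summable, so convergence holds almost surely whatever the joint law of the matrices. A countable set
of parameters s yields all s at once, since L_{n,p,1} is antitone in s and the limit is convex,
hence continuous, on s > 0.

The unconstrained maximum. It is either nonpositive or equal to a constrained maximum at some u > 0.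
On the unit sphere the p-norm is at least 1, so L_{n,p,1}(s) ≤ L_{n,p,1}(0) - s, and as p > 2 this
makes large u useless. The remaining bounded range of u is covered by a finite grid, using
antitonicity (`tendsto_groundStateEnergy`). -/

open scoped ENNReal NNReal

/-! ### Log-sum-exp and its derivatives. -/

section LogSumExp

variable {K : Type*} [Fintype K]

/-- The log-sum-exp function `log ∑ₖ exp zₖ`, a smooth approximation of the maximum. -/
noncomputable def logSumExp (z : K → ℝ) : ℝ := Real.log (∑ k, Real.exp (z k))

/-- The softmax weights, that is the gradient of `logSumExp`. -/
noncomputable def softmax (z : K → ℝ) (k : K) : ℝ := Real.exp (z k) / ∑ l, Real.exp (z l)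

lemma sum_exp_pos [Nonempty K] (z : K → ℝ) : 0 < ∑ k, Real.exp (z k) :=
  Finset.sum_pos (fun _ _ => Real.exp_pos _) Finset.univ_nonempty

lemma softmax_nonneg (z : K → ℝ) (k : K) : 0 ≤ softmax z k := by
  unfold softmax; positivity

lemma sum_softmax [Nonempty K] (z : K → ℝ) : ∑ k, softmax z k = 1 := by
  unfold softmax
  rw [← Finset.sum_div, div_self (sum_exp_pos z).ne']

lemma softmax_le_one [Nonempty K] (z : K → ℝ) (k : K) : softmax z k ≤ 1 := by
  rw [← sum_softmax z]
  exact Finset.single_le_sum (fun i _ => softmax_nonneg z i) (Finset.mem_univ k)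

lemma le_logSumExp (z : K → ℝ) (k : K) : z k ≤ logSumExp z := by
  rw [logSumExp, ← Real.log_exp (z k)]
  refine Real.log_le_log (Real.exp_pos _) ?_
  exact Finset.single_le_sum (f := fun i => Real.exp (z i)) (fun i _ => (Real.exp_pos _).le)
    (Finset.mem_univ k)

lemma logSumExp_le [Nonempty K] (z : K → ℝ) {M : ℝ} (h : ∀ k, z k ≤ M) :
    logSumExp z ≤ M + Real.log (Fintype.card K) := by
  have hc : (0 : ℝ) < Fintype.card K := by exact_mod_cast Fintype.card_pos
  rw [logSumExp, ← Real.log_exp M, ← Real.log_mul (Real.exp_pos _).ne' hc.ne']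
  refine Real.log_le_log (sum_exp_pos z) ?_
  calc ∑ k, Real.exp (z k) ≤ ∑ _k : K, Real.exp M :=
        Finset.sum_le_sum fun k _ => Real.exp_le_exp.2 (h k)
    _ = _ := by simp [mul_comm]

lemma hasFDerivAt_logSumExp [Nonempty K] (z : K → ℝ) :
    HasFDerivAt logSumExp
      (∑ k, softmax z k • (ContinuousLinearMap.proj k : (K → ℝ) →L[ℝ] ℝ)) z := by
  have h1 : HasFDerivAt (fun z : K → ℝ => ∑ k, Real.exp (z k))
      (∑ k, Real.exp (z k) • (ContinuousLinearMap.proj k : (K → ℝ) →L[ℝ] ℝ)) z :=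
    HasFDerivAt.fun_sum fun k _ => (hasFDerivAt_apply k z).exp
  refine (h1.log (sum_exp_pos z).ne').congr_fderiv ?_
  rw [Finset.smul_sum]
  refine Finset.sum_congr rfl fun k _ => ?_
  rw [smul_smul, softmax]
  congr 1
  field_simp

/-- Each weight equals exp(z_k - logSumExp z), so the chain rule and the gradient of log-sum-exp
suffice. -/
lemma hasFDerivAt_softmax [Nonempty K] (z : K → ℝ) (k : K) :
    HasFDerivAt (fun z => softmax z k)
      (softmax z k • ((ContinuousLinearMap.proj k : (K → ℝ) →L[ℝ] ℝ)
        - ∑ l, softmax z l • (ContinuousLinearMap.proj l : (K → ℝ) →L[ℝ] ℝ))) z := by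
  have h2 : (fun z : K → ℝ => softmax z k) = fun z => Real.exp (z k - logSumExp z) := by
    funext z
    rw [Real.exp_sub, logSumExp, Real.exp_log (sum_exp_pos z), softmax]
  have h3 : HasFDerivAt (fun z => Real.exp (z k - logSumExp z)) _ z :=
    ((hasFDerivAt_apply (𝕜 := ℝ) k z).sub (hasFDerivAt_logSumExp z)).exp
  rw [h2]
  refine h3.congr_fderiv ?_
  congr 1
  exact (congrFun h2 z).symm

lemma continuous_logSumExp [Nonempty K] : Continuous (logSumExp : (K → ℝ) → ℝ) :=
  continuous_iff_continuousAt.2 fun z => (hasFDerivAt_logSumExp z).continuousAt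

lemma continuous_softmax [Nonempty K] (k : K) : Continuous fun z : K → ℝ => softmax z k :=
  continuous_iff_continuousAt.2 fun z => (hasFDerivAt_softmax z k).continuousAt

end LogSumExp

/-! ### Gaussian integration by parts. -/

section Stein

variable {W : Type*} [NormedAddCommGroup W] [NormedSpace ℝ W] [MeasurableSpace W] [BorelSpace W]
  [SecondCountableTopology W] [CompleteSpace W] {μ : Measure W} [IsGaussian μ]

/-- **Gaussian integration by parts** for a centered Gaussian measure on a Banach space. -/
lemma integral_mul_dual_eq_of_isGaussian (hμ : ∫ x, x ∂μ = 0) {h : W → ℝ} {h' : W → StrongDual ℝ W}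
    (hd : ∀ w, HasFDerivAt h (h' w) w) (hc : Continuous h') {C : ℝ} (hC : ∀ w, |h w| ≤ C)
    (hC' : ∀ w, ‖h' w‖ ≤ C) (L : StrongDual ℝ W) :
    ∫ w, h w * L w ∂μ = ∫ q : W × W, h' q.1 q.2 * L q.2 ∂(μ.prod μ) := by
  have hh : Continuous h := continuous_iff_continuousAt.2 fun z => (hd z).continuousAt
  have hC0 : 0 ≤ C := (abs_nonneg _).trans (hC 0)
  -- Rotating a pair of independent copies preserves its law. The proof differentiates at angle 0 an
  -- expectation that this invariance makes constant.
  let R1 : ℝ → W × W → W := fun θ q => Real.cos θ • q.1 + Real.sin θ • q.2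
  let R2 : ℝ → W × W → W := fun θ q => -Real.sin θ • q.1 + Real.cos θ • q.2
  have hR1c : ∀ θ, Continuous (R1 θ) := fun θ => by fun_prop
  have hR2c : ∀ θ, Continuous (R2 θ) := fun θ => by fun_prop
  have hR1 : ∀ θ q, ‖R1 θ q‖ ≤ ‖q.1‖ + ‖q.2‖ := fun θ q => by
    refine (norm_add_le _ _).trans ?_
    rw [norm_smul, norm_smul]
    exact add_le_add (mul_le_of_le_one_left (norm_nonneg _) (Real.abs_cos_le_one θ))
      (mul_le_of_le_one_left (norm_nonneg _) (Real.abs_sin_le_one θ))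
  have hR2 : ∀ θ q, ‖R2 θ q‖ ≤ ‖q.1‖ + ‖q.2‖ := fun θ q => by
    refine (norm_add_le _ _).trans ?_
    rw [norm_smul, norm_smul, norm_neg]
    exact add_le_add (mul_le_of_le_one_left (norm_nonneg _) (Real.abs_sin_le_one θ))
      (mul_le_of_le_one_left (norm_nonneg _) (Real.abs_cos_le_one θ))
  have hdR1 : ∀ θ q, HasDerivAt (fun θ => R1 θ q) (R2 θ q) θ := fun θ q =>
    ((Real.hasDerivAt_cos θ).smul_const q.1).add ((Real.hasDerivAt_sin θ).smul_const q.2)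
  have hdR2 : ∀ θ q, HasDerivAt (fun θ => R2 θ q) (-R1 θ q) θ := fun θ q => by
    have := ((Real.hasDerivAt_sin θ).neg.smul_const q.1).add
      ((Real.hasDerivAt_cos θ).smul_const q.2)
    refine this.congr_deriv ?_
    rw [show R1 θ q = Real.cos θ • q.1 + Real.sin θ • q.2 from rfl, neg_add, neg_smul, neg_smul]
  let F : ℝ → W × W → ℝ := fun θ q => h (R1 θ q) * L (R2 θ q)
  let F' : ℝ → W × W → ℝ := fun θ q =>
    h' (R1 θ q) (R2 θ q) * L (R2 θ q) + h (R1 θ q) * L (-R1 θ q)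
  have hFc : ∀ θ, Continuous (F θ) := fun θ =>
    (hh.comp (hR1c θ)).mul (L.continuous.comp (hR2c θ))
  have hF'c : ∀ θ, Continuous (F' θ) := fun θ =>
    (((hc.comp (hR1c θ)).clm_apply (hR2c θ)).mul (L.continuous.comp (hR2c θ))).add
      ((hh.comp (hR1c θ)).mul (L.continuous.comp (hR1c θ).neg))
  have hm1 : MemLp (fun q : W × W => ‖q.1‖) 2 (μ.prod μ) :=
    (IsGaussian.memLp_two_id (μ := μ)).norm.comp_fst μ
  have hm2 : MemLp (fun q : W × W => ‖q.2‖) 2 (μ.prod μ) :=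
    (IsGaussian.memLp_two_id (μ := μ)).norm.comp_snd μ
  have hm : MemLp (fun q : W × W => ‖q.1‖ + ‖q.2‖) 2 (μ.prod μ) := hm1.add hm2
  have hi1 : Integrable (fun q : W × W => ‖q.1‖ + ‖q.2‖) (μ.prod μ) := hm.integrable (by norm_num)
  have hi2 : Integrable (fun q : W × W => (‖q.1‖ + ‖q.2‖) ^ 2) (μ.prod μ) := hm.integrable_sq
  -- After undoing the rotation the two factors are independent and `L` has mean zero.
  have hconst : ∀ θ, ∫ q, F θ q ∂(μ.prod μ) = 0 := fun θ => by
    have h1 : ∫ q, F θ q ∂(μ.prod μ) = ∫ q : W × W, h q.1 * L q.2 ∂(μ.prod μ) := by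
      conv_rhs => rw [← IsGaussian.map_rotation_eq_self (μ := μ) (by simpa using hμ) θ]
      rw [integral_map (ContinuousLinearMap.continuous _).aemeasurable]
      · rfl
      · exact (by fun_prop : Continuous fun q : W × W => h q.1 * L q.2).aestronglyMeasurable
    rw [h1, integral_prod_mul (μ := μ) (ν := μ) h L, IsGaussian.integral_dual, hμ]
    simp
  have key := hasDerivAt_integral_of_dominated_loc_of_deriv_le (μ := μ.prod μ) (F := F) (F' := F')
    (x₀ := (0 : ℝ)) (s := Set.univ)
    (bound := fun q => C * ‖L‖ * (‖q.1‖ + ‖q.2‖) ^ 2 + C * ‖L‖ * (‖q.1‖ + ‖q.2‖)) univ_mem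
    (Eventually.of_forall fun θ => (hFc θ).aestronglyMeasurable) ?_ (hF'c 0).aestronglyMeasurable
    ?_ ((hi2.const_mul _).add (hi1.const_mul _)) ?_
  · obtain ⟨-, k2⟩ := key
    have k3 : ∫ q, F' 0 q ∂(μ.prod μ) = 0 := by
      refine k2.unique ?_
      have : (fun θ => ∫ q, F θ q ∂(μ.prod μ)) = fun _ => 0 := funext hconst
      rw [this]
      exact hasDerivAt_const _ _
    -- At angle 0 the vanishing derivative is exactly the difference of the two sides of the claim.
    have hF'0 : F' 0 = fun q => h' q.1 q.2 * L q.2 - h q.1 * L q.1 := by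
      funext q; simp [F', R1, R2]; ring
    rw [hF'0] at k3
    have i1 : Integrable (fun q : W × W => h q.1 * L q.1) (μ.prod μ) := by
      refine (hi1.const_mul (C * ‖L‖)).mono'
        (by fun_prop : Continuous fun q : W × W => h q.1 * L q.1).aestronglyMeasurable ?_
      refine Eventually.of_forall fun q => ?_
      rw [norm_mul, mul_assoc]
      refine mul_le_mul (hC _) ((L.le_opNorm _).trans ?_) (norm_nonneg _) hC0
      gcongr
      exact le_add_of_nonneg_right (norm_nonneg _)
    have i2 : Integrable (fun q : W × W => h' q.1 q.2 * L q.2) (μ.prod μ) := by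
      refine (hi2.const_mul (C * ‖L‖)).mono' ?_ ?_
      · exact Continuous.aestronglyMeasurable (((hc.comp continuous_fst).clm_apply
          continuous_snd).mul (L.continuous.comp continuous_snd))
      refine Eventually.of_forall fun q => ?_
      have e1 : ‖q.2‖ ≤ ‖q.1‖ + ‖q.2‖ := le_add_of_nonneg_left (norm_nonneg _)
      rw [norm_mul]
      calc ‖h' q.1 q.2‖ * ‖L q.2‖ ≤ (C * (‖q.1‖ + ‖q.2‖)) * (‖L‖ * (‖q.1‖ + ‖q.2‖)) := by
            refine mul_le_mul (((h' q.1).le_opNorm _).trans ?_) ((L.le_opNorm _).trans ?_)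
              (norm_nonneg _) (by positivity)
            · exact mul_le_mul (hC' _) e1 (norm_nonneg _) hC0
            · gcongr
        _ = _ := by ring
    rw [integral_sub i2 i1, integral_fun_fst (fun w => h w * L w)] at k3
    simp at k3
    linarith
  · refine (hi1.const_mul (C * ‖L‖)).mono' (hFc 0).aestronglyMeasurable ?_
    refine Eventually.of_forall fun q => ?_
    rw [norm_mul, mul_assoc]
    exact mul_le_mul (hC _) ((L.le_opNorm _).trans (by gcongr; exact hR2 _ _)) (norm_nonneg _) hC0
  · refine Eventually.of_forall fun q θ _ => (norm_add_le _ _).trans ?_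
    rw [norm_mul, norm_mul, map_neg, norm_neg]
    refine add_le_add ?_ ?_
    · calc ‖h' (R1 θ q) (R2 θ q)‖ * ‖L (R2 θ q)‖
            ≤ (C * (‖q.1‖ + ‖q.2‖)) * (‖L‖ * (‖q.1‖ + ‖q.2‖)) := by
            refine mul_le_mul (((h' _).le_opNorm _).trans ?_) ((L.le_opNorm _).trans ?_)
              (norm_nonneg _) (by positivity)
            · exact mul_le_mul (hC' _) (hR2 _ _) (norm_nonneg _) hC0
            · gcongr; exact hR2 _ _
        _ = _ := by ring
    · rw [mul_assoc]
      exact mul_le_mul (hC _) ((L.le_opNorm _).trans (by gcongr; exact hR1 _ _))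
        (norm_nonneg _) hC0
  · refine Eventually.of_forall fun q θ _ => ?_
    exact ((hd _).comp_hasDerivAt θ (hdR1 θ q)).mul (L.hasFDerivAt.comp_hasDerivAt θ (hdR2 θ q))

end Stein

/-! ### Sudakov–Fernique comparison for log-sum-exp. -/

section SudakovFernique

variable {K : Type*} [Fintype K] {W : Type*} [NormedAddCommGroup W] [NormedSpace ℝ W]

lemma abs_logSumExp_le [Nonempty K] (z : K → ℝ) :
    |logSumExp z| ≤ ∑ k, |z k| + Real.log (Fintype.card K) := by
  have hc : (1 : ℝ) ≤ Fintype.card K := by exact_mod_cast Fintype.card_pos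
  have h0 := Real.log_nonneg hc
  have h1 : ∀ k, |z k| ≤ ∑ k, |z k| := fun k =>
    Finset.single_le_sum (f := fun k => |z k|) (fun _ _ => abs_nonneg _) (Finset.mem_univ k)
  rw [abs_le]
  constructor
  · obtain ⟨k⟩ := (inferInstance : Nonempty K)
    linarith [le_logSumExp z k, neg_abs_le (z k), h1 k]
  · exact logSumExp_le z fun k => (le_abs_self _).trans (h1 k)

lemma continuous_softmax_dual [Nonempty K] (V : K → StrongDual ℝ W) (c : K → ℝ) (k : K) :
    Continuous fun w => softmax (fun k => V k w + c k) k :=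
  (continuous_softmax k).comp (by fun_prop : Continuous fun w k => V k w + c k)

variable [MeasurableSpace W] [BorelSpace W] {μ : Measure W} [IsGaussian μ]

lemma integrable_logSumExp [Nonempty K] (V : K → StrongDual ℝ W) (c : K → ℝ) :
    Integrable (fun w => logSumExp fun k => V k w + c k) μ := by
  have hint : Integrable (fun w => ∑ k, |V k w + c k| + Real.log (Fintype.card K)) μ :=
    (integrable_finsetSum _ fun k _ =>
      ((IsGaussian.integrable_dual μ (V k)).add (integrable_const _)).abs).add
      (integrable_const _)
  refine hint.mono' ?_ (Eventually.of_forall fun w => abs_logSumExp_le _)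
  exact (continuous_logSumExp.comp (by fun_prop)).aestronglyMeasurable

lemma integrable_dual_mul_dual (L M : StrongDual ℝ W) :
    Integrable (fun w => L w * M w) μ :=
  (IsGaussian.memLp_dual μ L 2 (by simp)).integrable_mul (IsGaussian.memLp_dual μ M 2 (by simp))

variable [SecondCountableTopology W] [CompleteSpace W]

/-- Gaussian integration by parts for the softmax weights. -/
lemma integral_softmax_mul_dual [Nonempty K] (hμ : ∫ x, x ∂μ = 0) (V : K → StrongDual ℝ W)
    (c : K → ℝ) (k : K) (L : StrongDual ℝ W) :
    ∫ w, softmax (fun k => V k w + c k) k * L w ∂μ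
      = ∫ w, softmax (fun k => V k w + c k) k * (∫ v, V k v * L v ∂μ
          - ∑ l, softmax (fun k => V k w + c k) l * ∫ v, V l v * L v ∂μ) ∂μ := by
  set p : K → W → ℝ := fun k w => softmax (fun k => V k w + c k) k with hp
  have hp0 : ∀ k w, 0 ≤ p k w := fun k w => softmax_nonneg _ _
  have hp1 : ∀ k w, p k w ≤ 1 := fun k w => softmax_le_one _ _
  have hpc : ∀ k, Continuous (p k) := continuous_softmax_dual V c
  have hd : ∀ w, HasFDerivAt (p k) (p k w • (V k - ∑ l, p l w • V l)) w := by
    intro w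
    have h1 : HasFDerivAt (fun w => fun k => V k w + c k) (ContinuousLinearMap.pi V) w :=
      hasFDerivAt_pi.2 fun k => (V k).hasFDerivAt.add_const _
    refine ((hasFDerivAt_softmax (fun k => V k w + c k) k).comp w h1).congr_fderiv ?_
    ext v
    simp [hp]
  have hS : 0 ≤ ∑ l, ‖V l‖ := Finset.sum_nonneg fun _ _ => norm_nonneg _
  rw [integral_mul_dual_eq_of_isGaussian hμ hd (C := 1 + ‖V k‖ + ∑ l, ‖V l‖) ?_ ?_ ?_ L]
  · have hint : Integrable (fun q : W × W =>
        (p k q.1 • (V k - ∑ l, p l q.1 • V l)) q.2 * L q.2) (μ.prod μ) := by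
      have hterm : ∀ l, Integrable (fun q : W × W => V l q.2 * L q.2) (μ.prod μ) := fun l =>
        (integrable_dual_mul_dual (μ := μ) (V l) L).comp_snd μ
      have h2 : ∀ (g : W → ℝ) l, Continuous g → (∀ w, |g w| ≤ 1) →
          Integrable (fun q : W × W => g q.1 * (V l q.2 * L q.2)) (μ.prod μ) :=
        fun g l hg hg1 => (hterm l).bdd_mul (c := 1)
          (hg.comp continuous_fst).aestronglyMeasurable (Eventually.of_forall fun q => hg1 q.1)
      have h3 : (fun q : W × W => (p k q.1 • (V k - ∑ l, p l q.1 • V l)) q.2 * L q.2)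
          = fun q => p k q.1 * (V k q.2 * L q.2)
            - ∑ l, (p k q.1 * p l q.1) * (V l q.2 * L q.2) := by
        funext q
        simp [_root_.sum_apply, mul_sub, sub_mul, Finset.mul_sum, Finset.sum_mul,
          mul_assoc]
      rw [h3]
      refine (h2 _ k (hpc k) fun w => ?_).sub
        (integrable_finsetSum _ fun l _ => h2 _ l ((hpc k).mul (hpc l)) fun w => ?_)
      · rw [abs_of_nonneg (hp0 k w)]; exact hp1 k w
      · rw [Pi.mul_apply, abs_of_nonneg (mul_nonneg (hp0 k w) (hp0 l w))]
        exact mul_le_one₀ (hp1 k w) (hp0 l w) (hp1 l w)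
    rw [integral_prod _ hint]
    refine integral_congr_ae (Eventually.of_forall fun w => ?_)
    simp only
    have h4 : ∀ v, (p k w • (V k - ∑ l, p l w • V l)) v * L v
        = p k w * (V k v * L v - ∑ l, p l w * (V l v * L v)) := by
      intro v
      simp [_root_.sum_apply, sub_mul, Finset.sum_mul, mul_assoc]
    simp_rw [h4]
    rw [integral_const_mul, integral_sub (integrable_dual_mul_dual _ _)
      (integrable_finsetSum _ fun l _ => (integrable_dual_mul_dual _ _).const_mul _),
      integral_finsetSum _ fun l _ => (integrable_dual_mul_dual _ _).const_mul _]
    simp_rw [integral_const_mul]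
    rfl
  · fun_prop
  · intro w
    rw [abs_of_nonneg (hp0 k w)]
    linarith [hp1 k w, norm_nonneg (V k)]
  · intro w
    have e1 : ‖∑ l, p l w • V l‖ ≤ ∑ l, ‖V l‖ := by
      refine (norm_sum_le _ _).trans (Finset.sum_le_sum fun l _ => ?_)
      rw [norm_smul, Real.norm_of_nonneg (hp0 l w)]
      exact mul_le_of_le_one_left (norm_nonneg _) (hp1 l w)
    have e2 := norm_sub_le (V k) (∑ l, p l w • V l)
    rw [norm_smul, Real.norm_of_nonneg (hp0 k w)]
    refine (mul_le_of_le_one_left (norm_nonneg _) (hp1 k w)).trans ?_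
    linarith

/-- A quadratic form which is conditionally negative on probability weights. -/
lemma sum_mul_diag_sub_sum_nonneg {p : K → ℝ} (hp : ∀ k, 0 ≤ p k) (hp1 : ∑ k, p k = 1)
    {D : K → K → ℝ} (hD : ∀ k l, D k l + D l k ≤ D k k + D l l) :
    0 ≤ ∑ k, p k * (D k k - ∑ l, p l * D l k) := by
  -- This symmetrised double sum is twice the quantity in the goal, because the weights add up to
  -- one.
  have h1 : 0 ≤ ∑ k, ∑ l, p k * p l * (D k k + D l l - (D k l + D l k)) :=
    Finset.sum_nonneg fun k _ => Finset.sum_nonneg fun l _ =>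
      mul_nonneg (mul_nonneg (hp k) (hp l)) (by linarith [hD k l])
  have e1 : ∑ k, ∑ l, p k * p l * D k k = ∑ k, p k * D k k := by
    refine Finset.sum_congr rfl fun k _ => ?_
    calc ∑ l, p k * p l * D k k = (∑ l, p l) * (p k * D k k) := by
          rw [Finset.sum_mul]; exact Finset.sum_congr rfl fun l _ => by ring
      _ = _ := by rw [hp1, one_mul]
  have e2 : ∑ k, ∑ l, p k * p l * D l l = ∑ k, p k * D k k := by
    rw [← e1, Finset.sum_comm]
    exact Finset.sum_congr rfl fun k _ => Finset.sum_congr rfl fun l _ => by ring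
  have e3 : ∑ k, ∑ l, p k * p l * D l k = ∑ k, p k * ∑ l, p l * D l k := by
    refine Finset.sum_congr rfl fun k _ => ?_
    rw [Finset.mul_sum]
    exact Finset.sum_congr rfl fun l _ => by ring
  have e4 : ∑ k, ∑ l, p k * p l * D k l = ∑ k, p k * ∑ l, p l * D l k := by
    rw [← e3, Finset.sum_comm]
    exact Finset.sum_congr rfl fun k _ => Finset.sum_congr rfl fun l _ => by ring
  simp_rw [mul_sub, mul_add, Finset.sum_sub_distrib, Finset.sum_add_distrib] at h1 ⊢
  linarith

/-- **Sudakov–Fernique comparison** for the log-sum-exp of two uncorrelated Gaussian families. -/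
lemma integral_logSumExp_le_of_increments [Nonempty K] (hμ : ∫ x, x ∂μ = 0)
    (A B : K → StrongDual ℝ W) (c : K → ℝ) (hAB : ∀ k l, ∫ w, A k w * B l w ∂μ = 0)
    (hle : ∀ k l, ∫ w, (A k w - A l w) ^ 2 ∂μ ≤ ∫ w, (B k w - B l w) ^ 2 ∂μ) :
    ∫ w, logSumExp (fun k => A k w + c k) ∂μ ≤ ∫ w, logSumExp (fun k => B k w + c k) ∂μ := by
  -- The path runs from `A` at angle 0 to `B` at angle π/2, and `U` is its velocity. The aim is that
  -- the expected log-sum-exp increases along it.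
  let V : ℝ → K → StrongDual ℝ W := fun θ k => Real.cos θ • A k + Real.sin θ • B k
  let U : ℝ → K → StrongDual ℝ W := fun θ k => -Real.sin θ • A k + Real.cos θ • B k
  let Φ : ℝ → ℝ := fun θ => ∫ w, logSumExp (fun k => V θ k w + c k) ∂μ
  let D : K → K → ℝ := fun k l => ∫ w, B k w * B l w ∂μ - ∫ w, A k w * A l w ∂μ
  have hcov : ∀ θ k l, ∫ w, V θ l w * U θ k w ∂μ = Real.sin θ * Real.cos θ * D l k := by
    intro θ k l
    have e : ∀ w, V θ l w * U θ k w = Real.sin θ * Real.cos θ * (B l w * B k w)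
        - Real.sin θ * Real.cos θ * (A l w * A k w) + Real.cos θ ^ 2 * (A l w * B k w)
        - Real.sin θ ^ 2 * (A k w * B l w) := by
      intro w; simp [V, U]; ring
    have I : ∀ (r : ℝ) (L M : StrongDual ℝ W), Integrable (fun w => r * (L w * M w)) μ :=
      fun r L M => (integrable_dual_mul_dual L M).const_mul r
    simp_rw [e]
    rw [integral_sub, integral_add, integral_sub (I _ _ _) (I _ _ _)]
    · simp_rw [integral_const_mul, hAB]
      simp only [D]; ring
    · exact (I _ _ _).sub (I _ _ _)
    · exact I _ _ _
    · exact ((I _ _ _).sub (I _ _ _)).add (I _ _ _)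
    · exact I _ _ _
  -- The hypothesis on increments, rewritten in terms of covariances.
  have hD : ∀ k l, D k l + D l k ≤ D k k + D l l := by
    intro k l
    have e : ∀ M : K → StrongDual ℝ W, ∫ w, (M k w - M l w) ^ 2 ∂μ
        = ∫ w, M k w * M k w ∂μ + ∫ w, M l w * M l w ∂μ - 2 * ∫ w, M k w * M l w ∂μ := by
      intro M
      have e' : ∀ w, (M k w - M l w) ^ 2 = M k w * M k w + M l w * M l w
          - 2 * (M k w * M l w) := fun w => by ring
      simp_rw [e']
      rw [integral_sub, integral_add (integrable_dual_mul_dual _ _) (integrable_dual_mul_dual _ _),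
        integral_const_mul]
      · exact (integrable_dual_mul_dual _ _).add (integrable_dual_mul_dual _ _)
      · exact (integrable_dual_mul_dual _ _).const_mul _
    have s : ∀ M : K → StrongDual ℝ W, ∫ w, M l w * M k w ∂μ = ∫ w, M k w * M l w ∂μ := fun M => by
      simp_rw [mul_comm]
    have := hle k l
    rw [e, e] at this
    simp only [D]
    rw [s A, s B]
    linarith
  have hderiv : ∀ θ, HasDerivAt Φ
      (∫ w, ∑ k, softmax (fun k => V θ k w + c k) k * U θ k w ∂μ) θ := by
    intro θ₀
    refine (hasDerivAt_integral_of_dominated_loc_of_deriv_le (μ := μ)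
      (F' := fun θ w => ∑ k, softmax (fun k => V θ k w + c k) k * U θ k w)
      (s := Set.univ) (bound := fun w => ∑ k, (‖A k‖ + ‖B k‖) * ‖w‖) univ_mem
      (Eventually.of_forall fun θ => (integrable_logSumExp (V θ) c).aestronglyMeasurable)
      (integrable_logSumExp (V θ₀) c) ?_ ?_ ?_ ?_).2
    · refine Continuous.aestronglyMeasurable ?_
      exact continuous_finsetSum _ fun k _ =>
        (continuous_softmax_dual (V θ₀) c k).mul (U θ₀ k).continuous
    · refine Eventually.of_forall fun w θ _ => (norm_sum_le _ _).trans ?_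
      refine Finset.sum_le_sum fun k _ => ?_
      rw [norm_mul, Real.norm_of_nonneg (softmax_nonneg _ _)]
      refine (mul_le_of_le_one_left (norm_nonneg _) (softmax_le_one _ _)).trans ?_
      refine ((U θ k).le_opNorm w).trans ?_
      gcongr
      refine (norm_add_le _ _).trans ?_
      rw [norm_smul, norm_smul, norm_neg]
      exact add_le_add (mul_le_of_le_one_left (norm_nonneg _) (Real.abs_sin_le_one θ))
        (mul_le_of_le_one_left (norm_nonneg _) (Real.abs_cos_le_one θ))
    · exact integrable_finsetSum _ fun k _ => (IsGaussian.integrable_id (μ := μ)).norm.const_mul _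
    · refine Eventually.of_forall fun w θ _ => ?_
      have h1 : HasDerivAt (fun θ => fun k => V θ k w + c k) (fun k => U θ k w) θ := by
        refine hasDerivAt_pi.2 fun k => HasDerivAt.add_const _ ?_
        exact ((Real.hasDerivAt_cos θ).mul_const (A k w)).add
          ((Real.hasDerivAt_sin θ).mul_const (B k w))
      refine ((hasFDerivAt_logSumExp _).comp_hasDerivAt θ h1).congr_deriv ?_
      simp
  have hpos : ∀ θ ∈ Set.Icc 0 (Real.pi / 2),
      0 ≤ ∫ w, ∑ k, softmax (fun k => V θ k w + c k) k * U θ k w ∂μ := by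
    intro θ hθ
    have hsc : 0 ≤ Real.sin θ * Real.cos θ :=
      mul_nonneg (Real.sin_nonneg_of_nonneg_of_le_pi hθ.1 (by linarith [hθ.2, Real.pi_pos]))
        (Real.cos_nonneg_of_neg_pi_div_two_le_of_le (by linarith [hθ.1, Real.pi_pos]) hθ.2)
    have hpc : ∀ k, Continuous fun w => softmax (fun k => V θ k w + c k) k := 
      continuous_softmax_dual (V θ) c
    have hpb : ∀ k w, ‖softmax (fun k => V θ k w + c k) k‖ ≤ 1 := fun k w => by
      rw [Real.norm_of_nonneg (softmax_nonneg _ _)]; exact softmax_le_one _ _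
    rw [integral_finsetSum _ fun k _ => (IsGaussian.integrable_dual μ (U θ k)).bdd_mul (c := 1)
      (hpc k).aestronglyMeasurable (Eventually.of_forall (hpb k))]
    -- Integration by parts leaves only covariances of `V` with `U`, so the integrand becomes sin θ
    -- cos θ times the form treated in `sum_mul_diag_sub_sum_nonneg`.
    simp_rw [integral_softmax_mul_dual hμ (V θ) c _ (U θ _), hcov]
    rw [← integral_finsetSum]
    · refine integral_nonneg fun w => ?_
      have := mul_nonneg hsc (sum_mul_diag_sub_sum_nonneg
        (fun k => softmax_nonneg (fun k => V θ k w + c k) k) (sum_softmax _) hD)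
      rw [Finset.mul_sum] at this
      refine this.trans (le_of_eq (Finset.sum_congr rfl fun k _ => ?_))
      simp_rw [mul_sub, Finset.mul_sum]
      congr 1
      · ring
      · exact Finset.sum_congr rfl fun l _ => by ring
    · intro k _
      refine Integrable.bdd_mul (c := 1) ?_ (hpc k).aestronglyMeasurable
        (Eventually.of_forall (hpb k))
      refine (integrable_const _).sub (integrable_finsetSum _ fun l _ => ?_)
      exact (integrable_const _).bdd_mul (c := 1) (hpc l).aestronglyMeasurable
        (Eventually.of_forall (hpb l))
  have hmono : MonotoneOn Φ (Set.Icc 0 (Real.pi / 2)) := by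
    refine monotoneOn_of_deriv_nonneg (convex_Icc _ _)
      (fun θ _ => (hderiv θ).continuousAt.continuousWithinAt)
      (fun θ _ => (hderiv θ).differentiableAt.differentiableWithinAt) fun θ hθ => ?_
    rw [(hderiv θ).deriv]
    exact hpos θ (interior_subset hθ)
  have := hmono (Set.left_mem_Icc.2 (by positivity)) (Set.right_mem_Icc.2 (by positivity))
    (by positivity : (0 : ℝ) ≤ Real.pi / 2)
  simpa [Φ, V] using this

end SudakovFernique

/-! ### Fourth-moment concentration by rotation. -/

section Concentration

/-- Jensen's inequality for the fourth power and a finite measure. -/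
lemma ofReal_integral_pow_four_le {α : Type*} [MeasurableSpace α] {ν : Measure α}
    [IsFiniteMeasure ν] {f : α → ℝ} (hf : Integrable f ν) :
    ENNReal.ofReal ((∫ x, f x ∂ν) ^ 4)
      ≤ ENNReal.ofReal (ν.real Set.univ ^ 3) * ∫⁻ x, ENNReal.ofReal (f x ^ 4) ∂ν := by
  rcases eq_zero_or_neZero ν with rfl | hν
  · simp
  set c := ν.real Set.univ with hc
  have hc0 : 0 < c := by
    rw [hc, measureReal_def]
    exact ENNReal.toReal_pos (NeZero.ne _) (measure_ne_top _ _)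
  by_cases htop : ∫⁻ x, ENNReal.ofReal (f x ^ 4) ∂ν = ⊤
  · rw [htop, ENNReal.mul_top]
    · exact le_top
    · simp only [ne_eq, ENNReal.ofReal_eq_zero, not_le]; positivity
  have hint : Integrable (fun x => f x ^ 4) ν :=
    (lintegral_ofReal_ne_top_iff_integrable (hf.aestronglyMeasurable.pow 4)
      (Eventually.of_forall fun x => Even.pow_nonneg (by decide) (f x))).1 htop
  rw [← ofReal_integral_eq_lintegral_ofReal hint (Eventually.of_forall fun x => Even.pow_nonneg (by decide) (f x)),
    ← ENNReal.ofReal_mul (by positivity)]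
  refine ENNReal.ofReal_le_ofReal ?_
  set m := (∫ x, f x ∂ν) / c with hm
  have hmc : ∫ x, f x ∂ν = c * m := by rw [hm]; field_simp
  -- The tangent line to t⁴ at the mean `m` lies below the graph; its linear part integrates to
  -- zero.
  have h1 : ∫ x, (m ^ 4 + 4 * m ^ 3 * (f x - m)) ∂ν ≤ ∫ x, f x ^ 4 ∂ν := by
    refine integral_mono ?_ hint fun x => ?_
    · exact (integrable_const _).add ((hf.sub (integrable_const _)).const_mul _)
    · have : f x ^ 4 - (m ^ 4 + 4 * m ^ 3 * (f x - m))
          = (f x - m) ^ 2 * ((f x + m) ^ 2 + 2 * m ^ 2) := by ring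
      have h2 : 0 ≤ (f x - m) ^ 2 * ((f x + m) ^ 2 + 2 * m ^ 2) := by positivity
      simp only
      linarith
  have hs : Integrable (fun x => 4 * m ^ 3 * (f x - m)) ν :=
    (hf.sub (integrable_const m)).const_mul _
  rw [integral_add (integrable_const _) hs,
    integral_const_mul, integral_sub hf (integrable_const _), hmc] at h1
  simp only [integral_const, smul_eq_mul, ← hc, sub_self, mul_zero, add_zero] at h1
  rw [hmc]
  calc (c * m) ^ 4 = c ^ 3 * (c * m ^ 4) := by ring
    _ ≤ _ := by gcongr

lemma sum_mul_pow_four_le {K : Type*} [Fintype K] {p : K → ℝ} (hp : ∀ k, 0 ≤ p k)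
    (hp1 : ∑ k, p k = 1) (v : K → ℝ) : (∑ k, p k * v k) ^ 4 ≤ ∑ k, p k * v k ^ 4 := by
  have := (Even.convexOn_pow (𝕜 := ℝ) (n := 4) (by decide)).map_sum_le (t := Finset.univ)
    (w := p) (p := v) (fun k _ => hp k) hp1 (fun _ _ => Set.mem_univ _)
  simpa using this

variable {K : Type*} [Fintype K] {W : Type*} [NormedAddCommGroup W] [NormedSpace ℝ W]
  [MeasurableSpace W] [BorelSpace W] [SecondCountableTopology W] [CompleteSpace W]
  {μ : Measure W} [IsGaussian μ]

/-- Concentration of the log-sum-exp of a Gaussian family, in fourth moment: the proof rotates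
an independent copy into the original. -/
lemma lintegral_logSumExp_sub_pow_four_le [Nonempty K] (hμ : ∫ x, x ∂μ = 0)
    (V : K → StrongDual ℝ W) (c : K → ℝ) {B : ℝ≥0∞}
    (hB : ∀ k, ∫⁻ w, ENNReal.ofReal (V k w ^ 4) ∂μ ≤ B) :
    ∫⁻ q : W × W, ENNReal.ofReal ((logSumExp (fun k => V k q.2 + c k)
        - logSumExp (fun k => V k q.1 + c k)) ^ 4) ∂(μ.prod μ)
      ≤ ENNReal.ofReal ((Real.pi / 2) ^ 4) * B := by
  set p : K → W → ℝ := fun k w => softmax (fun k => V k w + c k) k with hp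
  have hp0 : ∀ k w, 0 ≤ p k w := fun k w => softmax_nonneg _ _
  have hps : ∀ w, ∑ k, p k w = 1 := fun w => sum_softmax _
  have hpc : ∀ k, Continuous (p k) := continuous_softmax_dual V c
  -- The derivative of the smoothed maximum at the first point, in the direction of the second.
  set g : W × W → ℝ := fun q => ∑ k, p k q.1 * V k q.2 with hg
  have hgc : Continuous g := continuous_finsetSum _ fun k _ =>
    ((hpc k).comp continuous_fst).mul ((V k).continuous.comp continuous_snd)
  have hrc : Continuous fun x : (W × W) × ℝ => ContinuousLinearMap.rotation x.2 x.1 := by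
    simp only [ContinuousLinearMap.rotation_apply]
    fun_prop
  have hgi : ∫⁻ q, ENNReal.ofReal (g q ^ 4) ∂(μ.prod μ) ≤ B := by
    have hm : Measurable fun q => ENNReal.ofReal (g q ^ 4) := by fun_prop
    rw [lintegral_prod _ hm.aemeasurable]
    have : ∀ x, ∫⁻ y, ENNReal.ofReal (g (x, y) ^ 4) ∂μ ≤ B := by
      intro x
      calc ∫⁻ y, ENNReal.ofReal (g (x, y) ^ 4) ∂μ
          ≤ ∫⁻ y, ∑ k, ENNReal.ofReal (p k x) * ENNReal.ofReal (V k y ^ 4) ∂μ := by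
            refine lintegral_mono fun y => ?_
            simp_rw [← ENNReal.ofReal_mul (hp0 _ x)]
            rw [← ENNReal.ofReal_sum_of_nonneg fun k _ => mul_nonneg (hp0 k x) (by positivity)]
            exact ENNReal.ofReal_le_ofReal
              (sum_mul_pow_four_le (fun k => hp0 k x) (hps x) fun k => V k y)
        _ = ∑ k, ENNReal.ofReal (p k x) * ∫⁻ y, ENNReal.ofReal (V k y ^ 4) ∂μ := by
            rw [lintegral_finsetSum _ fun k _ => by fun_prop]
            refine Finset.sum_congr rfl fun k _ => lintegral_const_mul _ (by fun_prop)
        _ ≤ ∑ k, ENNReal.ofReal (p k x) * B := by gcongr with k; exact hB k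
        _ = B := by
            rw [← Finset.sum_mul, ← ENNReal.ofReal_sum_of_nonneg fun k _ => hp0 k x, hps x]
            simp
    calc _ ≤ ∫⁻ _, B ∂μ := lintegral_mono this
      _ = B := by simp
  have hrot : ∀ θ : ℝ, ∫⁻ q, ENNReal.ofReal (g (ContinuousLinearMap.rotation θ q) ^ 4) ∂(μ.prod μ)
      ≤ B := fun θ => by
    refine le_trans (le_of_eq ?_) hgi
    conv_rhs => rw [← IsGaussian.map_rotation_eq_self (μ := μ) (by simpa using hμ) θ]
    rw [lintegral_map (by fun_prop) (by fun_prop)]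
  have hpi : (0 : ℝ) ≤ Real.pi / 2 := by positivity
  -- The difference between the copies is the integral of `g` along the quarter turn joining them,
  -- and Jensen in the angle moves the fourth power inside. Each angle then contributes the same by
  -- rotation invariance.
  have hpath : ∀ q : W × W, ENNReal.ofReal ((logSumExp (fun k => V k q.2 + c k)
      - logSumExp (fun k => V k q.1 + c k)) ^ 4) ≤ ENNReal.ofReal ((Real.pi / 2) ^ 3) *
        ∫⁻ θ in Set.Ioc 0 (Real.pi / 2),
          ENNReal.ofReal (g (ContinuousLinearMap.rotation θ q) ^ 4) := by
    intro q
    have hrq : Continuous fun θ : ℝ => ContinuousLinearMap.rotation θ q := by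
      simp only [ContinuousLinearMap.rotation_apply]
      fun_prop
    have hcg : Continuous fun θ : ℝ => g (ContinuousLinearMap.rotation θ q) := hgc.comp hrq
    have hd : ∀ θ, HasDerivAt (fun θ : ℝ => logSumExp fun k =>
        V k (Real.cos θ • q.1 + Real.sin θ • q.2) + c k)
          (g (ContinuousLinearMap.rotation θ q)) θ := by
      intro θ
      have h0 : HasDerivAt (fun θ : ℝ => Real.cos θ • q.1 + Real.sin θ • q.2)
          (-Real.sin θ • q.1 + Real.cos θ • q.2) θ :=
        ((Real.hasDerivAt_cos θ).smul_const q.1).add ((Real.hasDerivAt_sin θ).smul_const q.2)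
      have h2 : ∀ k, HasDerivAt (fun θ : ℝ => V k (Real.cos θ • q.1 + Real.sin θ • q.2))
          (V k (-Real.sin θ • q.1 + Real.cos θ • q.2)) θ := fun k =>
        (V k).hasFDerivAt.comp_hasDerivAt θ h0
      have h1 : HasDerivAt (fun θ => fun k => V k (Real.cos θ • q.1 + Real.sin θ • q.2) + c k)
          (fun k => V k (-Real.sin θ • q.1 + Real.cos θ • q.2)) θ :=
        hasDerivAt_pi.2 fun k => (h2 k).add_const _
      refine ((hasFDerivAt_logSumExp _).comp_hasDerivAt θ h1).congr_deriv ?_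
      simp [hg, hp, ContinuousLinearMap.rotation_apply]
    have hftc := intervalIntegral.integral_eq_sub_of_hasDerivAt (a := 0) (b := Real.pi / 2)
      (fun θ _ => hd θ) (hcg.intervalIntegrable _ _)
    simp only [Real.cos_pi_div_two, Real.sin_pi_div_two, Real.cos_zero, Real.sin_zero, zero_smul,
      one_smul, zero_add, add_zero] at hftc
    rw [← hftc, intervalIntegral.integral_of_le hpi]
    have := ofReal_integral_pow_four_le (ν := volume.restrict (Set.Ioc 0 (Real.pi / 2)))
      (f := fun θ => g (ContinuousLinearMap.rotation θ q))
      ((intervalIntegrable_iff_integrableOn_Ioc_of_le hpi).1 (hcg.intervalIntegrable _ _))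
    refine this.trans (le_of_eq ?_)
    simp [measureReal_def, hpi]
  calc _ ≤ ∫⁻ q, (ENNReal.ofReal ((Real.pi / 2) ^ 3) * ∫⁻ θ in Set.Ioc 0 (Real.pi / 2),
          ENNReal.ofReal (g (ContinuousLinearMap.rotation θ q) ^ 4)) ∂(μ.prod μ) :=
        lintegral_mono hpath
    _ = ENNReal.ofReal ((Real.pi / 2) ^ 3) * ∫⁻ θ in Set.Ioc 0 (Real.pi / 2),
          ∫⁻ q, ENNReal.ofReal (g (ContinuousLinearMap.rotation θ q) ^ 4) ∂(μ.prod μ) := by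
        rw [lintegral_const_mul', lintegral_lintegral_swap]
        · exact (ENNReal.continuous_ofReal.comp ((hgc.comp hrc).pow 4)).measurable.aemeasurable
        · simp
    _ ≤ ENNReal.ofReal ((Real.pi / 2) ^ 3) * ∫⁻ θ in Set.Ioc 0 (Real.pi / 2), B := by
        gcongr with θ; exact hrot θ
    _ = _ := by
        rw [setLIntegral_const, Real.volume_Ioc, sub_zero, mul_comm B, ← mul_assoc,
          ← ENNReal.ofReal_mul (by positivity)]
        congr 2

end Concentration

/-! ### Countable suprema of affine functions of a standard Gaussian vector. -/

section SupAffine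

/-- The fourth moment of the standard Gaussian distribution. -/
noncomputable def gaussianFourthMoment : ℝ≥0∞ := ∫⁻ t, ENNReal.ofReal (t ^ 4) ∂(gaussianReal 0 1)

lemma gaussianFourthMoment_ne_top : gaussianFourthMoment ≠ ⊤ := by
  have h : MemLp (id : ℝ → ℝ) 4 (gaussianReal 0 1) := memLp_id_gaussianReal' 4 (by simp)
  have h' : Integrable (fun t : ℝ => t ^ 4) (gaussianReal 0 1) := by
    have := h.integrable_norm_pow (p := 4) (by norm_num)
    simpa [Even.pow_abs (show Even 4 by decide)] using this
  exact (lintegral_ofReal_ne_top_iff_integrable (by fun_prop)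
    (Eventually.of_forall fun t => Even.pow_nonneg (by decide) t)).2 h'

/-- The smooth approximation at inverse temperature `N + 1` of the maximum of the first `N + 1`
functions in a sequence. -/
noncomputable def smoothMax (z : ℕ → ℝ) (N : ℕ) : ℝ :=
  ((N : ℝ) + 1)⁻¹ * logSumExp fun k : Fin (N + 1) => ((N : ℝ) + 1) * z k

lemma le_smoothMax (z : ℕ → ℝ) {k N : ℕ} (h : k ≤ N) : z k ≤ smoothMax z N := by
  have hN : (0 : ℝ) < (N : ℝ) + 1 := by positivity
  have := le_logSumExp (fun k : Fin (N + 1) => ((N : ℝ) + 1) * z k) ⟨k, Nat.lt_succ_of_le h⟩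
  rw [smoothMax, ← div_eq_inv_mul, le_div_iff₀ hN, mul_comm]
  exact this

/-- The entropy cost is log(number of terms)/(inverse temperature). Tying both to N + 1 makes it
vanish, so one limit in N both removes the smoothing and exhausts the sequence. -/
lemma smoothMax_le {z : ℕ → ℝ} {M : ℝ} (h : ∀ k, z k ≤ M) (N : ℕ) :
    smoothMax z N ≤ M + Real.log ((N : ℝ) + 1) / ((N : ℝ) + 1) := by
  have hN : (0 : ℝ) < (N : ℝ) + 1 := by positivity
  have := logSumExp_le (fun k : Fin (N + 1) => ((N : ℝ) + 1) * z k) (M := ((N : ℝ) + 1) * M)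
    fun k => mul_le_mul_of_nonneg_left (h k) hN.le
  rw [smoothMax, ← div_eq_inv_mul, div_le_iff₀ hN]
  refine this.trans (le_of_eq ?_)
  simp
  field_simp

lemma tendsto_log_div_self : Tendsto (fun N : ℕ => Real.log ((N : ℝ) + 1) / ((N : ℝ) + 1))
    atTop (𝓝 0) := by
  have h1 : Tendsto (fun x : ℝ => Real.log x / x) atTop (𝓝 0) := by
    simpa using Real.isLittleO_log_id_atTop.tendsto_div_nhds_zero
  exact h1.comp (tendsto_atTop_add_const_right _ _ tendsto_natCast_atTop_atTop)

lemma tendsto_smoothMax {z : ℕ → ℝ} (hz : BddAbove (Set.range z)) :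
    Tendsto (smoothMax z) atTop (𝓝 (⨆ k, z k)) := by
  rw [tendsto_order]
  constructor
  · intro r hr
    obtain ⟨k, hk⟩ := exists_lt_of_lt_ciSup hr
    filter_upwards [eventually_ge_atTop k] with N hN
    exact hk.trans_le (le_smoothMax z hN)
  · intro r hr
    have h1 : Tendsto (fun N : ℕ => (⨆ k, z k) + Real.log ((N : ℝ) + 1) / ((N : ℝ) + 1)) atTop
        (𝓝 ((⨆ k, z k) + 0)) := tendsto_const_nhds.add tendsto_log_div_self
    rw [add_zero] at h1
    filter_upwards [h1.eventually_lt_const hr] with N hN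
    exact (smoothMax_le (fun k => le_ciSup hz k) N).trans_lt hN

lemma log_div_self_le_one (N : ℕ) : Real.log ((N : ℝ) + 1) / ((N : ℝ) + 1) ≤ 1 := by
  have hN : (0 : ℝ) < (N : ℝ) + 1 := by positivity
  rw [div_le_one hN]
  linarith [Real.log_le_sub_one_of_pos hN]

variable {E : Type*} [NormedAddCommGroup E] [InnerProductSpace ℝ E]

/-- The supremum of a sequence of affine functions on an inner product space. -/
noncomputable def supAffine (a : ℕ → E) (c : ℕ → ℝ) (w : E) : ℝ := ⨆ k, (inner ℝ (a k) w + c k)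

variable {a : ℕ → E} {c : ℕ → ℝ} {R C : ℝ}

lemma abs_inner_add_le (ha : ∀ k, ‖a k‖ ≤ R) (hc : ∀ k, |c k| ≤ C) (w : E) (k : ℕ) :
    |inner ℝ (a k) w + c k| ≤ R * ‖w‖ + C := by
  refine (abs_add_le _ _).trans (add_le_add ?_ (hc k))
  exact (abs_real_inner_le_norm _ _).trans (mul_le_mul_of_nonneg_right (ha k) (norm_nonneg _))

lemma bddAbove_affine (ha : ∀ k, ‖a k‖ ≤ R) (hc : ∀ k, |c k| ≤ C) (w : E) :
    BddAbove (Set.range fun k => inner ℝ (a k) w + c k) := by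
  refine ⟨R * ‖w‖ + C, ?_⟩
  rintro _ ⟨k, rfl⟩
  exact (le_abs_self _).trans (abs_inner_add_le ha hc w k)

lemma abs_supAffine_le (ha : ∀ k, ‖a k‖ ≤ R) (hc : ∀ k, |c k| ≤ C) (w : E) :
    |supAffine a c w| ≤ R * ‖w‖ + C := by
  rw [abs_le]
  constructor
  · exact (abs_le.1 (abs_inner_add_le ha hc w 0)).1.trans (le_ciSup (bddAbove_affine ha hc w) 0)
  · exact ciSup_le fun k => (le_abs_self _).trans (abs_inner_add_le ha hc w k)

variable [MeasurableSpace E] [BorelSpace E]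

lemma measurable_smoothMax_affine (a : ℕ → E) (c : ℕ → ℝ) (N : ℕ) :
    Measurable fun w => smoothMax (fun k => inner ℝ (a k) w + c k) N := by
  have h : Continuous fun w : E => fun k : Fin (N + 1) =>
      ((N : ℝ) + 1) * (inner ℝ (a k) w + c k) := by fun_prop
  exact (continuous_const.mul (continuous_logSumExp.comp h)).measurable

variable [FiniteDimensional ℝ E]

lemma stdGaussian_map_inner (a : E) :
    (stdGaussian E).map (fun w => inner ℝ a w) = gaussianReal 0 (‖a‖₊ ^ 2) := by
  have h := IsGaussian.map_eq_gaussianReal (μ := stdGaussian E) (innerSL ℝ a)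
  rw [variance_dual_stdGaussian, integral_strongDual_stdGaussian, innerSL_apply_norm] at h
  have e : (‖a‖ ^ 2).toNNReal = ‖a‖₊ ^ 2 := by
    rw [Real.toNNReal_pow (norm_nonneg _), norm_toNNReal]
  rw [e] at h
  exact h

lemma stdGaussian_map_inner_eq_map_mul (a : E) :
    (stdGaussian E).map (fun w => inner ℝ a w) = (gaussianReal 0 1).map (fun t => ‖a‖ * t) := by
  rw [stdGaussian_map_inner, gaussianReal_map_const_mul]
  congr 1
  · simp
  · ext; simp

lemma integral_inner_sq_stdGaussian (a : E) :
    ∫ w, inner ℝ a w ^ 2 ∂(stdGaussian E) = ‖a‖ ^ 2 := by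
  have h1 : ∫ w, inner ℝ a w ^ 2 ∂(stdGaussian E)
      = ∫ t, t ^ 2 ∂((stdGaussian E).map (fun w => inner ℝ a w)) := by
    rw [integral_map (by fun_prop) (by fun_prop)]
  have h2 := variance_fun_id_gaussianReal (μ := 0) (v := 1)
  rw [variance_eq_integral (by fun_prop)] at h2
  simp at h2
  rw [h1, stdGaussian_map_inner_eq_map_mul, integral_map (by fun_prop) (by fun_prop)]
  simp_rw [mul_pow]
  rw [integral_const_mul, h2, mul_one]

lemma lintegral_inner_pow_four_stdGaussian (a : E) :
    ∫⁻ w, ENNReal.ofReal (inner ℝ a w ^ 4) ∂(stdGaussian E)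
      = ENNReal.ofReal (‖a‖ ^ 4) * gaussianFourthMoment := by
  have h1 : ∫⁻ w, ENNReal.ofReal (inner ℝ a w ^ 4) ∂(stdGaussian E)
      = ∫⁻ t, ENNReal.ofReal (t ^ 4) ∂((stdGaussian E).map (fun w => inner ℝ a w)) := by
    rw [lintegral_map (by fun_prop) (by fun_prop)]
  rw [h1, stdGaussian_map_inner_eq_map_mul, lintegral_map (by fun_prop) (by fun_prop)]
  simp_rw [mul_pow]
  simp_rw [ENNReal.ofReal_mul (show 0 ≤ ‖a‖ ^ 4 by positivity)]
  rw [lintegral_const_mul _ (by fun_prop), gaussianFourthMoment]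

lemma measurable_supAffine (a : ℕ → E) (c : ℕ → ℝ) : Measurable (supAffine a c) := by
  unfold supAffine
  exact Measurable.iSup fun k => by fun_prop

lemma integrable_supAffine (ha : ∀ k, ‖a k‖ ≤ R) (hc : ∀ k, |c k| ≤ C) :
    Integrable (supAffine a c) (stdGaussian E) := by
  have hi : Integrable (fun w : E => R * ‖w‖ + C) (stdGaussian E) :=
    ((IsGaussian.integrable_id (μ := stdGaussian E)).norm.const_mul _).add (integrable_const _)
  exact hi.mono' (measurable_supAffine a c).aestronglyMeasurable
    (Eventually.of_forall (abs_supAffine_le ha hc))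

lemma tendsto_integral_smoothMax (ha : ∀ k, ‖a k‖ ≤ R) (hc : ∀ k, |c k| ≤ C) :
    Tendsto (fun N => ∫ w, smoothMax (fun k => inner ℝ (a k) w + c k) N ∂(stdGaussian E)) atTop
      (𝓝 (∫ w, supAffine a c w ∂(stdGaussian E))) := by
  have hi : Integrable (fun w : E => R * ‖w‖ + C + 1) (stdGaussian E) :=
    (((IsGaussian.integrable_id (μ := stdGaussian E)).norm.const_mul _).add
      (integrable_const _)).add (integrable_const _)
  refine tendsto_integral_of_dominated_convergence _
    (fun N => (measurable_smoothMax_affine a c N).aestronglyMeasurable) hi (fun N => ?_)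
    (Eventually.of_forall fun w => tendsto_smoothMax (bddAbove_affine ha hc w))
  refine Eventually.of_forall fun w => ?_
  rw [Real.norm_eq_abs, abs_le]
  have h := abs_inner_add_le ha hc w
  constructor
  · have h1 := le_smoothMax (fun k => inner ℝ (a k) w + c k) (Nat.zero_le N)
    linarith [(abs_le.1 (h 0)).1]
  · have h1 := smoothMax_le (fun k => (le_abs_self _).trans (h k)) N
    linarith [log_div_self_le_one N]

/-- Fourth-moment concentration for two independent copies of a supremum of affine functions of a
standard Gaussian vector. -/
lemma lintegral_supAffine_sub_pow_four_le (ha : ∀ k, ‖a k‖ ≤ R) (hc : ∀ k, |c k| ≤ C) :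
    ∫⁻ q : E × E, ENNReal.ofReal ((supAffine a c q.2 - supAffine a c q.1) ^ 4)
        ∂((stdGaussian E).prod (stdGaussian E))
      ≤ ENNReal.ofReal ((Real.pi / 2) ^ 4) * (ENNReal.ofReal (R ^ 4) * gaussianFourthMoment) := by
  set f : ℕ → E → ℝ := fun N w => smoothMax (fun k => inner ℝ (a k) w + c k) N with hf
  have hfm : ∀ N, Measurable (f N) := measurable_smoothMax_affine a c
  have hlim : ∀ w, Tendsto (fun N => f N w) atTop (𝓝 (supAffine a c w)) := fun w =>
    tendsto_smoothMax (bddAbove_affine ha hc w)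
  have hN : ∀ N, ∫⁻ q : E × E, ENNReal.ofReal ((f N q.2 - f N q.1) ^ 4)
        ∂((stdGaussian E).prod (stdGaussian E))
      ≤ ENNReal.ofReal ((Real.pi / 2) ^ 4) * (ENNReal.ofReal (R ^ 4) * gaussianFourthMoment) := by
    intro N
    have hp : (0 : ℝ) < (N : ℝ) + 1 := by positivity
    have key := lintegral_logSumExp_sub_pow_four_le (μ := stdGaussian E) (by simp)
      (fun k : Fin (N + 1) => ((N : ℝ) + 1) • innerSL ℝ (a k)) (fun k => ((N : ℝ) + 1) * c k)
      (B := ENNReal.ofReal (((N : ℝ) + 1) ^ 4) *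
        (ENNReal.ofReal (R ^ 4) * gaussianFourthMoment)) (fun k => by
        have e : ∀ w : E, ((((N : ℝ) + 1) • innerSL ℝ (a k)) w) ^ 4
            = ((N : ℝ) + 1) ^ 4 * inner ℝ (a k) w ^ 4 := fun w => by
          rw [_root_.smul_apply, innerSL_apply_apply, smul_eq_mul, mul_pow]
        simp_rw [e, ENNReal.ofReal_mul (show 0 ≤ ((N : ℝ) + 1) ^ 4 by positivity)]
        rw [lintegral_const_mul _ (by fun_prop), lintegral_inner_pow_four_stdGaussian]
        gcongr
        exact ha k)
    have e : ∀ w : E, logSumExp (fun k : Fin (N + 1) => (((N : ℝ) + 1) • innerSL ℝ (a k)) w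
        + ((N : ℝ) + 1) * c k) = ((N : ℝ) + 1) * f N w := by
      intro w
      rw [hf]
      simp only [smoothMax]
      rw [mul_inv_cancel_left₀ hp.ne']
      congr 1
      funext k
      simp [mul_add]
    simp_rw [e, ← mul_sub, mul_pow,
      ENNReal.ofReal_mul (show 0 ≤ ((N : ℝ) + 1) ^ 4 by positivity)] at key
    rw [lintegral_const_mul _ (by fun_prop), mul_left_comm] at key
    -- The inverse temperature enters both sides as (N + 1)⁴ and cancels, so the bound is uniform in
    -- N and passes to the limit by Fatou.
    refine (ENNReal.mul_le_mul_iff_right ?_ ENNReal.ofReal_ne_top).1 key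
    simp only [ne_eq, ENNReal.ofReal_eq_zero, not_le]
    positivity
  calc _ = ∫⁻ q : E × E, liminf (fun N => ENNReal.ofReal ((f N q.2 - f N q.1) ^ 4)) atTop
        ∂((stdGaussian E).prod (stdGaussian E)) := by
        refine lintegral_congr fun q => (Tendsto.liminf_eq ?_).symm
        exact ENNReal.tendsto_ofReal (((hlim q.2).sub (hlim q.1)).pow 4)
    _ ≤ liminf (fun N => ∫⁻ q : E × E, ENNReal.ofReal ((f N q.2 - f N q.1) ^ 4)
        ∂((stdGaussian E).prod (stdGaussian E))) atTop :=
        lintegral_liminf_le fun N => by fun_prop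
    _ ≤ _ := by
        refine (liminf_le_liminf (Eventually.of_forall hN)).trans ?_
        simp

/-- Fourth-moment concentration of a supremum of affine functions of a standard Gaussian vector
around its mean. -/
lemma lintegral_supAffine_sub_integral_pow_four_le (ha : ∀ k, ‖a k‖ ≤ R) (hc : ∀ k, |c k| ≤ C) :
    ∫⁻ w, ENNReal.ofReal ((supAffine a c w - ∫ v, supAffine a c v ∂(stdGaussian E)) ^ 4)
        ∂(stdGaussian E)
      ≤ ENNReal.ofReal ((Real.pi / 2) ^ 4) * (ENNReal.ofReal (R ^ 4) * gaussianFourthMoment) := by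
  have hm := measurable_supAffine a c
  have hi := integrable_supAffine ha hc
  refine le_trans ?_ (lintegral_supAffine_sub_pow_four_le ha hc)
  rw [lintegral_prod _ (by fun_prop)]
  refine lintegral_mono fun w => ?_
  -- Jensen in one of the two copies turns a bound on their difference into a bound on the deviation
  -- from the mean.
  have := ofReal_integral_pow_four_le (ν := stdGaussian E)
    (f := fun v => supAffine a c v - supAffine a c w) (hi.sub (integrable_const _))
  rw [integral_sub hi (integrable_const _)] at this
  simp only [integral_const, probReal_univ, one_smul, one_pow, ENNReal.ofReal_one, one_mul] at this
  rw [show (supAffine a c w - ∫ v, supAffine a c v ∂(stdGaussian E)) ^ 4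
    = (∫ v, supAffine a c v ∂(stdGaussian E) - supAffine a c w) ^ 4 by ring]
  exact this

variable {E' : Type*} [NormedAddCommGroup E'] [InnerProductSpace ℝ E'] [FiniteDimensional ℝ E']
  [MeasurableSpace E'] [BorelSpace E'] {b : ℕ → E'} {R' : ℝ}

/-- **Sudakov–Fernique inequality** for countable suprema of affine functions of standard Gaussian
vectors. -/
theorem integral_supAffine_le_of_norm_sub_le (ha : ∀ k, ‖a k‖ ≤ R) (hb : ∀ k, ‖b k‖ ≤ R')
    (hc : ∀ k, |c k| ≤ C) (hab : ∀ k l, ‖a k - a l‖ ^ 2 ≤ ‖b k - b l‖ ^ 2) :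
    ∫ w, supAffine a c w ∂(stdGaussian E) ≤ ∫ w, supAffine b c w ∂(stdGaussian E') := by
  refine le_of_tendsto_of_tendsto' (tendsto_integral_smoothMax ha hc)
    (tendsto_integral_smoothMax hb hc) fun N => ?_
  have hp : (0 : ℝ) < (N : ℝ) + 1 := by positivity
  simp only [smoothMax]
  rw [integral_const_mul, integral_const_mul]
  refine mul_le_mul_of_nonneg_left ?_ (by positivity)
  -- Placing the two families on separate factors of a product makes them uncorrelated, as the
  -- interpolation requires.
  set A : Fin (N + 1) → StrongDual ℝ (E × E') := fun k =>
    (((N : ℝ) + 1) • innerSL ℝ (a k)) ∘L ContinuousLinearMap.fst ℝ E E' with hA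
  set B : Fin (N + 1) → StrongDual ℝ (E × E') := fun k =>
    (((N : ℝ) + 1) • innerSL ℝ (b k)) ∘L ContinuousLinearMap.snd ℝ E E' with hB
  have hAa : ∀ k q, A k q = ((N : ℝ) + 1) * inner ℝ (a k) q.1 := fun k q => by simp [hA]
  have hBa : ∀ k q, B k q = ((N : ℝ) + 1) * inner ℝ (b k) q.2 := fun k q => by simp [hB]
  have key := integral_logSumExp_le_of_increments (μ := (stdGaussian E).prod (stdGaussian E'))
    ?_ A B (fun k => ((N : ℝ) + 1) * c k) ?_ ?_
  · simp_rw [hAa, hBa, ← mul_add] at key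
    rwa [integral_fun_fst (fun x : E => logSumExp fun k : Fin (N + 1) =>
        ((N : ℝ) + 1) * (inner ℝ (a k) x + c k)),
      integral_fun_snd (fun x : E' => logSumExp fun k : Fin (N + 1) =>
        ((N : ℝ) + 1) * (inner ℝ (b k) x + c k)), probReal_univ, probReal_univ, one_smul,
      one_smul] at key
  · have h : Integrable (fun q : E × E' => q) ((stdGaussian E).prod (stdGaussian E')) :=
      IsGaussian.integrable_id
    refine Prod.ext ?_ ?_
    · rw [fst_integral h]
      rw [integral_fun_fst (fun x : E => x)]
      simp
    · rw [snd_integral h]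
      rw [integral_fun_snd (fun x : E' => x)]
      simp
  · intro k l
    have e : ∀ q : E × E', A k q * B l q
        = (((N : ℝ) + 1) * inner ℝ (a k) q.1) * (((N : ℝ) + 1) * inner ℝ (b l) q.2) := fun q => by
      rw [hAa, hBa]
    simp_rw [e]
    rw [integral_prod_mul (fun x : E => ((N : ℝ) + 1) * inner ℝ (a k) x)
      (fun x : E' => ((N : ℝ) + 1) * inner ℝ (b l) x), integral_const_mul]
    have := integral_strongDual_stdGaussian (innerSL ℝ (a k))
    simp only [innerSL_apply_apply] at this
    rw [this]
    simp
  · intro k l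
    simp_rw [hAa, hBa, ← mul_sub, ← inner_sub_left, mul_pow]
    rw [integral_const_mul, integral_const_mul,
      integral_fun_fst (fun x : E => inner ℝ (a k - a l) x ^ 2),
      integral_fun_snd (fun x : E' => inner ℝ (b k - b l) x ^ 2), integral_inner_sq_stdGaussian,
      integral_inner_sq_stdGaussian]
    simp only [probReal_univ, one_smul]
    exact mul_le_mul_of_nonneg_left (hab k l) (by positivity)

end SupAffine

/-! ### Quadratic forms as linear functionals of the matrix. -/

section Tensor

variable {n : ℕ}

/-- The rank-one matrix `x ⊗ x`, as a Euclidean vector. -/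
noncomputable def tensorSq (x : Fin n → ℝ) : EuclideanSpace ℝ (Fin n × Fin n) :=
  WithLp.toLp 2 fun ij => x ij.1 * x ij.2

/-- A square matrix as a Euclidean vector. -/
noncomputable def matrixVec (A : Matrix (Fin n) (Fin n) ℝ) : EuclideanSpace ℝ (Fin n × Fin n) :=
  WithLp.toLp 2 fun ij => A ij.1 ij.2

lemma inner_tensorSq_matrixVec (x : Fin n → ℝ) (A : Matrix (Fin n) (Fin n) ℝ) :
    inner ℝ (tensorSq x) (matrixVec A) = (A *ᵥ x) ⬝ᵥ x := by
  simp only [tensorSq, matrixVec, PiLp.inner_apply, Fintype.sum_prod_type, Matrix.mulVec,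
    dotProduct, Finset.sum_mul]
  refine Finset.sum_congr rfl fun i _ => Finset.sum_congr rfl fun j _ => ?_
  simp
  ring

/-- The covariance of the Gaussian process x ↦ ⟨Gx, x⟩ is the squared overlap; every comparison of
increments below rests on this. -/
lemma inner_tensorSq (x y : Fin n → ℝ) :
    inner ℝ (tensorSq x) (tensorSq y) = (x ⬝ᵥ y) ^ 2 := by
  simp only [tensorSq, PiLp.inner_apply, Fintype.sum_prod_type, dotProduct, sq, Finset.sum_mul_sum]
  refine Finset.sum_congr rfl fun i _ => Finset.sum_congr rfl fun j _ => ?_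
  simp
  ring

lemma norm_tensorSq_sub_sq (x y : Fin n → ℝ) :
    ‖tensorSq x - tensorSq y‖ ^ 2 = (x ⬝ᵥ x) ^ 2 + (y ⬝ᵥ y) ^ 2 - 2 * (x ⬝ᵥ y) ^ 2 := by
  rw [norm_sub_sq_real, ← real_inner_self_eq_norm_sq, ← real_inner_self_eq_norm_sq, inner_tensorSq,
    inner_tensorSq, inner_tensorSq]
  ring

lemma norm_tensorSq (x : Fin n → ℝ) : ‖tensorSq x‖ = x ⬝ᵥ x := by
  have h : 0 ≤ x ⬝ᵥ x := Finset.sum_nonneg fun i _ => mul_self_nonneg (x i)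
  rw [← sq_eq_sq₀ (norm_nonneg _) h, ← real_inner_self_eq_norm_sq, inner_tensorSq]

end Tensor

/-! ### The unit-overlap ground state as a countable supremum. -/

section Sphere

lemma exists_denseSeq_sphere (n : ℕ) : ∃ d : ℕ → Fin n → ℝ, (∀ k, d k ⬝ᵥ d k = n) ∧
    {x : Fin n → ℝ | x ⬝ᵥ x = n} ⊆ closure (Set.range d) := by
  have : Nonempty {x : Fin n → ℝ | x ⬝ᵥ x = n} := ⟨fun _ => 1, by simp [dotProduct]⟩
  refine ⟨fun k => (TopologicalSpace.denseSeq {x : Fin n → ℝ | x ⬝ᵥ x = n} k).1,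
    fun k => (TopologicalSpace.denseSeq {x : Fin n → ℝ | x ⬝ᵥ x = n} k).2, fun x hx => ?_⟩
  have h := TopologicalSpace.denseRange_denseSeq {x : Fin n → ℝ | x ⬝ᵥ x = n} ⟨x, hx⟩
  have h2 := image_closure_subset_closure_image continuous_subtype_val (Set.mem_image_of_mem _ h)
  rwa [← Set.range_comp] at h2

/-- A dense sequence in the sphere `|x|² = n` of `ℝⁿ`. -/
noncomputable def sphereSeq (n : ℕ) : ℕ → Fin n → ℝ := (exists_denseSeq_sphere n).choose

lemma sphereSeq_dotProduct_self (n k : ℕ) : sphereSeq n k ⬝ᵥ sphereSeq n k = n :=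
  (exists_denseSeq_sphere n).choose_spec.1 k

/-- The Gaussian coefficient of the energy at `x`. -/
noncomputable def energyCoeff {n : ℕ} (x : Fin n → ℝ) : EuclideanSpace ℝ (Fin n × Fin n) :=
  ((n : ℝ) * √n)⁻¹ • tensorSq x

/-- The deterministic term of the energy at `x`. -/
noncomputable def energyDrift {n : ℕ} (p s : ℝ) (x : Fin n → ℝ) : ℝ :=
  -(s * ((1 / (n : ℝ)) * ∑ i, |x i| ^ p))

lemma natCast_rpow_three_half (n : ℕ) : (n : ℝ) ^ (3 / 2 : ℝ) = n * √n := by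
  rcases Nat.eq_zero_or_pos n with rfl | hn
  · simp
  · have hn' : (0 : ℝ) < n := by exact_mod_cast hn
    rw [Real.sqrt_eq_rpow, show (3 / 2 : ℝ) = 1 + 1 / 2 by norm_num, Real.rpow_add hn',
      Real.rpow_one]

lemma penalizedEnergy_eq {n : ℕ} {p : ℝ} (hp : 0 < p) (s : ℝ) (A : Matrix (Fin n) (Fin n) ℝ)
    (x : Fin n → ℝ) :
    penalizedEnergy p s A x = inner ℝ (energyCoeff x) (matrixVec A) + energyDrift p s x := by
  rw [penalizedEnergy, energyCoeff, energyDrift, normalizedNorm_rpow hp, real_inner_smul_left,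
    inner_tensorSq_matrixVec, natCast_rpow_three_half]
  ring

/-- The random variable `L_{n,p,1}(s)`, as a supremum of affine functions of the matrix. -/
noncomputable def unitGroundState (p s : ℝ) (n : ℕ) : EuclideanSpace ℝ (Fin n × Fin n) → ℝ :=
  supAffine (fun k => energyCoeff (sphereSeq n k)) fun k => energyDrift p s (sphereSeq n k)

lemma normalizedNorm_two_sq_eq_one_iff {n : ℕ} (hn : 0 < n) (x : Fin n → ℝ) :
    normalizedNorm 2 x ^ 2 = 1 ↔ x ⬝ᵥ x = n := by
  have hn' : (n : ℝ) ≠ 0 := by exact_mod_cast hn.ne'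
  have : ∑ i, x i ^ 2 = x ⬝ᵥ x := Finset.sum_congr rfl fun i _ => sq (x i)
  rw [normalizedNorm_two_sq, this]
  field_simp

/-- The energy is continuous, so the supremum over a dense sequence agrees with that over the
sphere. This yields measurability and gives access to the Gaussian estimates for `supAffine`. -/
lemma constrainedGroundStateEnergy_one_eq {n : ℕ} (hn : 0 < n) {p : ℝ} (hp : 2 < p) (s : ℝ)
    (A : Matrix (Fin n) (Fin n) ℝ) :
    constrainedGroundStateEnergy p 1 s A = unitGroundState p s n (matrixVec A) := by
  have hp0 : 0 < p := by linarith
  have hlub := (isGreatest_constrainedGroundStateEnergy hn hp one_pos s A).isLUB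
  have hS : {x : Fin n → ℝ | normalizedNorm 2 x ^ 2 = 1} = {x | x ⬝ᵥ x = (n : ℝ)} := by
    ext x; exact normalizedNorm_two_sq_eq_one_iff hn x
  rw [hS] at hlub
  have hsub : penalizedEnergy p s A '' Set.range (sphereSeq n)
      ⊆ penalizedEnergy p s A '' {x | x ⬝ᵥ x = (n : ℝ)} := by
    refine Set.image_mono ?_
    rintro _ ⟨k, rfl⟩
    exact sphereSeq_dotProduct_self n k
  have hcl : penalizedEnergy p s A '' {x | x ⬝ᵥ x = (n : ℝ)}
      ⊆ closure (penalizedEnergy p s A '' Set.range (sphereSeq n)) :=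
    (Set.image_mono (exists_denseSeq_sphere n).choose_spec.2).trans
      (image_closure_subset_closure_image (continuous_penalizedEnergy hp0 s A))
  have h2 := (isLUB_iff_of_subset_of_subset_closure hsub hcl).2 hlub
  rw [← Set.range_comp] at h2
  rw [unitGroundState, supAffine, ← h2.csSup_eq (Set.range_nonempty _), iSup]
  congr 1
  refine congrArg Set.range (funext fun k => ?_)
  exact penalizedEnergy_eq hp0 s A _

/-- The energy at each point of the sphere has variance 1/n, the source of concentration. -/
lemma norm_energyCoeff {n : ℕ} (hn : 0 < n) {x : Fin n → ℝ} (hx : x ⬝ᵥ x = n) :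
    ‖energyCoeff x‖ = (√n)⁻¹ := by
  have hn' : (0 : ℝ) < n := by exact_mod_cast hn
  rw [energyCoeff, norm_smul, norm_tensorSq, hx, Real.norm_of_nonneg (by positivity)]
  field_simp

/-- A crude bound that grows with n. It serves only for integrability and bounded suprema, since
neither the concentration constant nor the comparison depends on the drift bound. -/
lemma abs_energyDrift_le {n : ℕ} (hn : 0 < n) {p : ℝ} (hp : 0 < p) (s : ℝ) {x : Fin n → ℝ}
    (hx : x ⬝ᵥ x = n) : |energyDrift p s x| ≤ |s| * √n ^ p := by
  have hn' : (0 : ℝ) < n := by exact_mod_cast hn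
  have h1 : ∀ i, |x i| ^ p ≤ √n ^ p := fun i => by
    refine Real.rpow_le_rpow (abs_nonneg _) (Real.abs_le_sqrt ?_) hp.le
    rw [← hx, sq]
    exact Finset.single_le_sum (f := fun j => x j * x j) (fun j _ => mul_self_nonneg _)
      (Finset.mem_univ i)
  have h2 : ∑ i, |x i| ^ p ≤ n * √n ^ p := by
    refine (Finset.sum_le_sum fun i _ => h1 i).trans (le_of_eq ?_)
    simp
  have h3 : 0 ≤ ∑ i, |x i| ^ p := Finset.sum_nonneg fun i _ => by positivity
  rw [energyDrift, abs_neg, abs_mul, abs_of_nonneg (show 0 ≤ 1 / (n : ℝ) * ∑ i, |x i| ^ p by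
    positivity)]
  refine mul_le_mul_of_nonneg_left ?_ (abs_nonneg s)
  rw [one_div, ← div_eq_inv_mul, div_le_iff₀ hn']
  linarith

lemma norm_energyCoeff_sphereSeq_le {n : ℕ} (hn : 0 < n) (k : ℕ) :
    ‖energyCoeff (sphereSeq n k)‖ ≤ (√n)⁻¹ :=
  (norm_energyCoeff hn (sphereSeq_dotProduct_self n k)).le

lemma abs_energyDrift_sphereSeq_le {n : ℕ} (hn : 0 < n) {p : ℝ} (hp : 0 < p) (s : ℝ) (k : ℕ) :
    |energyDrift p s (sphereSeq n k)| ≤ |s| * √n ^ p :=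
  abs_energyDrift_le hn hp s (sphereSeq_dotProduct_self n k)

lemma measurable_unitGroundState (p s : ℝ) (n : ℕ) : Measurable (unitGroundState p s n) :=
  measurable_supAffine _ _

lemma integrable_unitGroundState {n : ℕ} (hn : 0 < n) {p : ℝ} (hp : 0 < p) (s : ℝ) :
    Integrable (unitGroundState p s n) (stdGaussian (EuclideanSpace ℝ (Fin n × Fin n))) :=
  integrable_supAffine (norm_energyCoeff_sphereSeq_le hn) (abs_energyDrift_sphereSeq_le hn hp s)

/-- The energy of any point on the sphere is at most the ground state energy. -/
lemma energy_le_unitGroundState {n : ℕ} (hn : 0 < n) {p : ℝ} (hp : 2 < p) (s : ℝ) {x : Fin n → ℝ}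
    (hx : x ⬝ᵥ x = n) (w : EuclideanSpace ℝ (Fin n × Fin n)) :
    inner ℝ (energyCoeff x) w + energyDrift p s x ≤ unitGroundState p s n w := by
  have hw : w = matrixVec (Matrix.of fun i j => w (i, j)) := rfl
  rw [hw, ← penalizedEnergy_eq (by linarith), ← constrainedGroundStateEnergy_one_eq hn hp]
  exact (isGreatest_constrainedGroundStateEnergy hn hp one_pos s _).2
    ⟨x, (normalizedNorm_two_sq_eq_one_iff hn x).2 hx, rfl⟩

/-- The mean `E L_{n,p,1}(s)`. -/
noncomputable def meanGroundState (p s : ℝ) (n : ℕ) : ℝ :=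
  ∫ w, unitGroundState p s n w ∂(stdGaussian (EuclideanSpace ℝ (Fin n × Fin n)))

end Sphere

/-! ### Marginals of a standard Gaussian vector. -/

section Marginals

variable {E F : Type*} [NormedAddCommGroup E] [InnerProductSpace ℝ E] [FiniteDimensional ℝ E]
  [MeasurableSpace E] [BorelSpace E] [NormedAddCommGroup F] [InnerProductSpace ℝ F]
  [FiniteDimensional ℝ F] [MeasurableSpace F] [BorelSpace F]

/-- Characteristic functions: that of the image at `t` is the Gaussian one at `g t`, which depends
only on the norm. -/
lemma stdGaussian_map_of_inner_eq (f : E → F) (g : F → E) (hf : Measurable f)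
    (hfg : ∀ w t, inner ℝ (f w) t = inner ℝ w (g t)) (hg : ∀ t, ‖g t‖ = ‖t‖) :
    (stdGaussian E).map f = stdGaussian F := by
  have : IsProbabilityMeasure ((stdGaussian E).map f) :=
    Measure.isProbabilityMeasure_map hf.aemeasurable
  refine Measure.ext_of_charFun ?_
  ext t
  rw [charFun_apply, integral_map hf.aemeasurable (by fun_prop), charFun_stdGaussian, ← hg t,
    ← charFun_stdGaussian, charFun_apply]
  simp_rw [hfg]

lemma measurePreserving_fst_stdGaussian : MeasurePreserving
    (fun z : WithLp 2 (E × F) => z.fst) (stdGaussian (WithLp 2 (E × F))) (stdGaussian E) :=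
  ⟨(WithLp.fstL 2 ℝ E F).continuous.measurable, stdGaussian_map_of_inner_eq _
    (fun t => WithLp.toLp 2 (t, (0 : F))) (WithLp.fstL 2 ℝ E F).continuous.measurable
    (fun w t => by simp) (fun t => by simp)⟩

lemma measurePreserving_snd_stdGaussian : MeasurePreserving
    (fun z : WithLp 2 (E × F) => z.snd) (stdGaussian (WithLp 2 (E × F))) (stdGaussian F) :=
  ⟨(WithLp.sndL 2 ℝ E F).continuous.measurable, stdGaussian_map_of_inner_eq _
    (fun t => WithLp.toLp 2 ((0 : E), t)) (WithLp.sndL 2 ℝ E F).continuous.measurable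
    (fun w t => by simp) (fun t => by simp)⟩

end Marginals

/-! ### Superadditivity and the limit of the mean. -/

section MeanLimit

variable {p : ℝ}

lemma append_dotProduct_append {m k : ℕ} (x x' : Fin m → ℝ) (y y' : Fin k → ℝ) :
    Fin.append x y ⬝ᵥ Fin.append x' y' = x ⬝ᵥ x' + y ⬝ᵥ y' := by
  simp [dotProduct, Fin.sum_univ_add]

lemma mul_energyDrift_append {m k : ℕ} (hm : 0 < m) (hk : 0 < k) (p s : ℝ) (x : Fin m → ℝ)
    (y : Fin k → ℝ) : ((m : ℝ) + k) * energyDrift p s (Fin.append x y)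
      = m * energyDrift p s x + k * energyDrift p s y := by
  have hm' : (0 : ℝ) < m := by exact_mod_cast hm
  have hk' : (0 : ℝ) < k := by exact_mod_cast hk
  simp only [energyDrift, Fin.sum_univ_add, Fin.append_left, Fin.append_right, Nat.cast_add]
  field_simp
  ring

lemma norm_smul_energyCoeff_sub_sq {n : ℕ} (hn : 0 < n) {x y : Fin n → ℝ} (hx : x ⬝ᵥ x = n)
    (hy : y ⬝ᵥ y = n) : ‖(n : ℝ) • energyCoeff x - (n : ℝ) • energyCoeff y‖ ^ 2
      = 2 * n - 2 * ((x ⬝ᵥ y) ^ 2 / n) := by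
  have hn' : (0 : ℝ) < n := by exact_mod_cast hn
  have hs : √(n : ℝ) ^ 2 = n := Real.sq_sqrt hn'.le
  rw [energyCoeff, energyCoeff, ← smul_sub, ← smul_sub, smul_smul, norm_smul, mul_pow,
    norm_tensorSq_sub_sq, hx, hy, Real.norm_eq_abs, sq_abs, mul_pow, inv_pow, mul_pow, hs]
  field_simp
  ring

/-- Guerra–Toninelli superadditivity of the mean constrained ground state energy. -/
lemma mul_meanGroundState_add_le {m k : ℕ} (hm : 0 < m) (hk : 0 < k) (hp : 2 < p) (s : ℝ) :
    m * meanGroundState p s m + k * meanGroundState p s k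
      ≤ ((m : ℝ) + k) * meanGroundState p s (m + k) := by
  have hm' : (0 : ℝ) < m := by exact_mod_cast hm
  have hk' : (0 : ℝ) < k := by exact_mod_cast hk
  have hp0 : 0 < p := by linarith
  have hmk : 0 < m + k := by omega
  have hcast : ((m + k : ℕ) : ℝ) = m + k := by push_cast; ring
  -- The pairing function enumerates all pairs of points of the two dense sequences with a single
  -- index.
  let x : ℕ → Fin m → ℝ := fun q => sphereSeq m q.unpair.1
  let y : ℕ → Fin k → ℝ := fun q => sphereSeq k q.unpair.2
  have hx : ∀ q, x q ⬝ᵥ x q = m := fun q => sphereSeq_dotProduct_self _ _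
  have hy : ∀ q, y q ⬝ᵥ y q = k := fun q => sphereSeq_dotProduct_self _ _
  have hz : ∀ q, Fin.append (x q) (y q) ⬝ᵥ Fin.append (x q) (y q) = (m + k : ℕ) := fun q => by
    rw [append_dotProduct_append, hx, hy, hcast]
  let a : ℕ → EuclideanSpace ℝ (Fin (m + k) × Fin (m + k)) := fun q =>
    ((m + k : ℕ) : ℝ) • energyCoeff (Fin.append (x q) (y q))
  let b : ℕ → WithLp 2 (EuclideanSpace ℝ (Fin m × Fin m) × EuclideanSpace ℝ (Fin k × Fin k)) :=
    fun q => WithLp.toLp 2 ((m : ℝ) • energyCoeff (x q), (k : ℝ) • energyCoeff (y q))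
  let c : ℕ → ℝ := fun q => m * energyDrift p s (x q) + k * energyDrift p s (y q)
  have ha : ∀ q, ‖a q‖ ≤ ((m + k : ℕ) : ℝ) * (√(m + k : ℕ))⁻¹ := fun q => by
    rw [norm_smul, norm_energyCoeff hmk (hz q), Real.norm_of_nonneg (by positivity)]
  have hb : ∀ q, ‖b q‖ ≤ (m : ℝ) * (√m)⁻¹ + k * (√k)⁻¹ := fun q => by
    have e : ‖b q‖ ^ 2 = ((m : ℝ) * (√m)⁻¹) ^ 2 + ((k : ℝ) * (√k)⁻¹) ^ 2 := by
      rw [WithLp.prod_norm_sq_eq_of_L2]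
      simp only [b, norm_smul, norm_energyCoeff hm (hx q), norm_energyCoeff hk (hy q),
        Real.norm_natCast, WithLp.toLp_fst, WithLp.toLp_snd]
    have h1 : (0 : ℝ) ≤ (m : ℝ) * (√m)⁻¹ := by positivity
    have h2 : (0 : ℝ) ≤ (k : ℝ) * (√k)⁻¹ := by positivity
    refine (sq_le_sq₀ (norm_nonneg _) (add_nonneg h1 h2)).1 ?_
    rw [e]
    nlinarith [mul_nonneg h1 h2]
  have hc : ∀ q, |c q| ≤ m * (|s| * √m ^ p) + k * (|s| * √k ^ p) := fun q => by
    refine (abs_add_le _ _).trans ?_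
    rw [abs_mul, abs_mul, Nat.abs_cast, Nat.abs_cast]
    exact add_le_add (mul_le_mul_of_nonneg_left (abs_energyDrift_le hm hp0 s (hx q)) hm'.le)
      (mul_le_mul_of_nonneg_left (abs_energyDrift_le hk hp0 s (hy q)) hk'.le)
  have hinc : ∀ q r, ‖b q - b r‖ ^ 2 ≤ ‖a q - a r‖ ^ 2 := fun q r => by
    have e : ‖b q - b r‖ ^ 2 = (2 * m - 2 * ((x q ⬝ᵥ x r) ^ 2 / m))
        + (2 * k - 2 * ((y q ⬝ᵥ y r) ^ 2 / k)) := by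
      rw [← norm_smul_energyCoeff_sub_sq hm (hx q) (hx r),
        ← norm_smul_energyCoeff_sub_sq hk (hy q) (hy r), WithLp.prod_norm_sq_eq_of_L2]
      simp [b]
    rw [e, norm_smul_energyCoeff_sub_sq hmk (hz q) (hz r), append_dotProduct_append, hcast]
    -- Joint convexity of (r, n) ↦ r²/n; cross-multiplied, the gap is a perfect square.
    have h : (x q ⬝ᵥ x r + y q ⬝ᵥ y r) ^ 2 / ((m : ℝ) + k)
        ≤ (x q ⬝ᵥ x r) ^ 2 / m + (y q ⬝ᵥ y r) ^ 2 / k := by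
      rw [div_add_div _ _ hm'.ne' hk'.ne', div_le_div_iff₀ (by positivity) (by positivity)]
      linarith [sq_nonneg ((x q ⬝ᵥ x r) * k - (y q ⬝ᵥ y r) * m)]
    linarith
  have key := integral_supAffine_le_of_norm_sub_le hb ha hc hinc
  have hupper : ∫ w, supAffine a c w ∂(stdGaussian _) ≤ ((m : ℝ) + k) * meanGroundState p s (m + k) := by
    rw [meanGroundState, ← integral_const_mul]
    refine integral_mono (integrable_supAffine ha hc)
      ((integrable_unitGroundState hmk hp0 s).const_mul _) fun w => ciSup_le fun q => ?_
    have h := mul_le_mul_of_nonneg_left (energy_le_unitGroundState hmk hp s (hz q) w)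
      (show (0 : ℝ) ≤ m + k by positivity)
    rw [mul_add, mul_energyDrift_append hm hk] at h
    simp only [a, c, real_inner_smul_left, hcast]
    exact h
  have hlower : m * meanGroundState p s m + k * meanGroundState p s k
      ≤ ∫ w, supAffine b c w ∂(stdGaussian _) := by
    have hfst := measurePreserving_fst_stdGaussian
      (E := EuclideanSpace ℝ (Fin m × Fin m)) (F := EuclideanSpace ℝ (Fin k × Fin k))
    have hsnd := measurePreserving_snd_stdGaussian
      (E := EuclideanSpace ℝ (Fin m × Fin m)) (F := EuclideanSpace ℝ (Fin k × Fin k))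
    have i1 := hfst.integrable_comp_of_integrable (integrable_unitGroundState hm hp0 s)
    have i2 := hsnd.integrable_comp_of_integrable (integrable_unitGroundState hk hp0 s)
    rw [Function.comp_def] at i1 i2
    have e1 := integral_map hfst.aemeasurable
      (measurable_unitGroundState p s m).aestronglyMeasurable
    have e2 := integral_map hsnd.aemeasurable
      (measurable_unitGroundState p s k).aestronglyMeasurable
    rw [hfst.map_eq] at e1
    rw [hsnd.map_eq] at e2
    rw [meanGroundState, meanGroundState, e1, e2, ← integral_const_mul, ← integral_const_mul,
      ← integral_add (i1.const_mul _) (i2.const_mul _)]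
    refine integral_mono ((i1.const_mul _).add (i2.const_mul _)) (integrable_supAffine hb hc)
      fun z => ?_
    -- The block energy splits into a function of `i` plus a function of `j`, so the two suprema can
    -- be taken one at a time.
    have hij : ∀ i j, m * (inner ℝ (energyCoeff (sphereSeq m i)) z.fst
          + energyDrift p s (sphereSeq m i))
        + k * (inner ℝ (energyCoeff (sphereSeq k j)) z.snd + energyDrift p s (sphereSeq k j))
        ≤ supAffine b c z := fun i j => by
      refine le_trans (le_of_eq ?_) (le_ciSup (bddAbove_affine hb hc z) (Nat.pair i j))
      simp [b, c, x, y, real_inner_smul_left]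
      ring
    have hj : ∀ j, m * unitGroundState p s m z.fst
        + k * (inner ℝ (energyCoeff (sphereSeq k j)) z.snd + energyDrift p s (sphereSeq k j))
        ≤ supAffine b c z := fun j => by
      rw [← le_sub_iff_add_le, mul_comm, ← le_div_iff₀ hm']
      refine ciSup_le fun i => ?_
      rw [le_div_iff₀ hm', mul_comm, le_sub_iff_add_le]
      exact hij i j
    simp only
    rw [add_comm, ← le_sub_iff_add_le, mul_comm, ← le_div_iff₀ hk']
    refine ciSup_le fun j => ?_
    rw [le_div_iff₀ hk', mul_comm, le_sub_iff_add_le, add_comm]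
    exact hj j
  exact hlower.trans (key.trans hupper)

lemma energyDrift_nonpos {n : ℕ} {s : ℝ} (hs : 0 ≤ s) (x : Fin n → ℝ) :
    energyDrift p s x ≤ 0 := by
  rw [energyDrift, neg_nonpos]
  positivity

/-- Comparison with the linear process `⟨x, h⟩` bounds the mean ground state energy. -/
lemma meanGroundState_le {n : ℕ} (hn : 0 < n) (hp : 2 < p) {s : ℝ} (hs : 0 ≤ s) :
    meanGroundState p s n ≤ √2 := by
  have hn' : (0 : ℝ) < n := by exact_mod_cast hn
  have hp0 : 0 < p := by linarith
  have hsq : √(n : ℝ) ^ 2 = n := Real.sq_sqrt hn'.le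
  have h2 : √(2 : ℝ) ^ 2 = 2 := Real.sq_sqrt (by norm_num)
  let b : ℕ → EuclideanSpace ℝ (Fin n) := fun k => (√2 / n) • WithLp.toLp 2 (sphereSeq n k)
  have hdot : ∀ x y : Fin n → ℝ, inner ℝ (WithLp.toLp 2 x : EuclideanSpace ℝ (Fin n))
      (WithLp.toLp 2 y) = x ⬝ᵥ y := fun x y => by
    simp [PiLp.inner_apply, dotProduct, mul_comm]
  have hnorm : ∀ k, ‖(WithLp.toLp 2 (sphereSeq n k) : EuclideanSpace ℝ (Fin n))‖ ^ 2 = n :=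
    fun k => by rw [← real_inner_self_eq_norm_sq, hdot, sphereSeq_dotProduct_self]
  have hb : ∀ k, ‖b k‖ ≤ √2 / n * √n := fun k => by
    rw [norm_smul, Real.norm_of_nonneg (by positivity)]
    refine mul_le_mul_of_nonneg_left (Real.le_sqrt_of_sq_le (hnorm k).le) (by positivity)
  have hinc : ∀ k l, ‖energyCoeff (sphereSeq n k) - energyCoeff (sphereSeq n l)‖ ^ 2
      ≤ ‖b k - b l‖ ^ 2 := fun k l => by
    set r := sphereSeq n k ⬝ᵥ sphereSeq n l with hr
    have e1 : ‖b k - b l‖ ^ 2 = 4 * (n - r) / n ^ 2 := by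
      rw [← smul_sub, norm_smul, mul_pow, norm_sub_sq_real, hnorm, hnorm, hdot, ← hr,
        Real.norm_eq_abs, sq_abs, div_pow, h2]
      ring
    have e2 : ‖energyCoeff (sphereSeq n k) - energyCoeff (sphereSeq n l)‖ ^ 2
        = 2 * ((n - r) * (n + r)) / n ^ 3 := by
      rw [energyCoeff, energyCoeff, ← smul_sub, norm_smul, mul_pow, norm_tensorSq_sub_sq,
        sphereSeq_dotProduct_self, sphereSeq_dotProduct_self, Real.norm_eq_abs, sq_abs, inv_pow,
        mul_pow, hsq, ← hr]
      field_simp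
      ring
    have hrn : r ≤ n := by
      have := real_inner_le_norm (WithLp.toLp 2 (sphereSeq n k) : EuclideanSpace ℝ (Fin n))
        (WithLp.toLp 2 (sphereSeq n l))
      rw [hdot] at this
      nlinarith [hnorm k, hnorm l,
        sq_nonneg (‖(WithLp.toLp 2 (sphereSeq n k) : EuclideanSpace ℝ (Fin n))‖
          - ‖(WithLp.toLp 2 (sphereSeq n l) : EuclideanSpace ℝ (Fin n))‖)]
    rw [e1, e2, div_le_div_iff₀ (by positivity) (by positivity)]
    -- The factor √2 in `b` is what absorbs n + r ≤ 2n here.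
    have h3 : (n - r) * (n + r) ≤ (n - r) * (2 * n) :=
      mul_le_mul_of_nonneg_left (by linarith) (by linarith)
    have h4 : (0 : ℝ) ≤ (n : ℝ) ^ 2 := by positivity
    nlinarith [mul_le_mul_of_nonneg_right h3 h4]
  have hc := abs_energyDrift_sphereSeq_le hn hp0 s
  refine (integral_supAffine_le_of_norm_sub_le (norm_energyCoeff_sphereSeq_le hn) hb
    hc hinc).trans ?_
  have hi2 : Integrable (fun h : EuclideanSpace ℝ (Fin n) => ‖h‖ ^ 2) (stdGaussian _) := by
    have := (IsGaussian.memLp_two_id (μ := stdGaussian (EuclideanSpace ℝ (Fin n)))).norm.integrable_sq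
    exact this
  have hn2 : ∫ h : EuclideanSpace ℝ (Fin n), ‖h‖ ^ 2 ∂(stdGaussian _) = n := by
    have hcoord : ∀ (i : Fin n) (h : EuclideanSpace ℝ (Fin n)),
        h i ^ 2 = inner ℝ (EuclideanSpace.single i (1 : ℝ)) h ^ 2 := fun i h => by
      rw [EuclideanSpace.inner_single_left]; simp
    simp_rw [EuclideanSpace.real_norm_sq_eq, hcoord]
    rw [integral_finsetSum]
    · simp_rw [integral_inner_sq_stdGaussian]
      simp
    · intro i _
      exact (IsGaussian.memLp_dual (stdGaussian (EuclideanSpace ℝ (Fin n)))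
        (innerSL ℝ (EuclideanSpace.single i (1 : ℝ))) 2 (by simp)).integrable_sq
  have hint : Integrable (fun h : EuclideanSpace ℝ (Fin n) =>
      √2 / n * ((n + ‖h‖ ^ 2) / 2)) (stdGaussian _) :=
    (((integrable_const _).add hi2).div_const _).const_mul _
  calc _ ≤ ∫ h : EuclideanSpace ℝ (Fin n), √2 / n * ((n + ‖h‖ ^ 2) / 2) ∂(stdGaussian _) := by
        refine integral_mono (integrable_supAffine hb hc) hint fun h => ciSup_le fun k => ?_
        have h1 := energyDrift_nonpos (p := p) hs (sphereSeq n k)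
        have h3 := real_inner_le_norm (WithLp.toLp 2 (sphereSeq n k) : EuclideanSpace ℝ (Fin n)) h
        -- Cauchy–Schwarz followed by √n‖h‖ ≤ (n + ‖h‖²)/2, so that only the second moment of `h` is
        -- needed.
        have h4 : inner ℝ (WithLp.toLp 2 (sphereSeq n k) : EuclideanSpace ℝ (Fin n)) h
            ≤ (n + ‖h‖ ^ 2) / 2 := by
          nlinarith [hnorm k, sq_nonneg
            (‖(WithLp.toLp 2 (sphereSeq n k) : EuclideanSpace ℝ (Fin n))‖ - ‖h‖)]
        have h5 : inner ℝ (b k) h ≤ √2 / n * ((n + ‖h‖ ^ 2) / 2) := by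
          rw [real_inner_smul_left]
          exact mul_le_mul_of_nonneg_left h4 (by positivity)
        linarith
    _ = √2 := by
        rw [integral_const_mul, integral_div, integral_add (integrable_const _) hi2, hn2]
        simp
        field_simp

/-- The limit of `E L_{n,p,1}(s)`. -/
noncomputable def limitGroundState (p s : ℝ) : ℝ := limUnder atTop (meanGroundState p s)

/-- Fekete's lemma applied to -n E_n(s), with the uniform bound √2 supplying the lower bound. -/
lemma tendsto_meanGroundState (hp : 2 < p) {s : ℝ} (hs : 0 ≤ s) :
    Tendsto (meanGroundState p s) atTop (𝓝 (limitGroundState p s)) := by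
  have hsub : Subadditive fun n : ℕ => -((n : ℝ) * meanGroundState p s n) := by
    intro m k
    rcases Nat.eq_zero_or_pos m with rfl | hm
    · simp
    rcases Nat.eq_zero_or_pos k with rfl | hk
    · simp
    have := mul_meanGroundState_add_le hm hk hp s
    push_cast
    linarith
  have hbdd : BddBelow (Set.range fun n : ℕ => -((n : ℝ) * meanGroundState p s n) / n) := by
    refine ⟨-√2, ?_⟩
    rintro _ ⟨n, rfl⟩
    rcases Nat.eq_zero_or_pos n with rfl | hn
    · simp
    have hn' : (0 : ℝ) < n := by exact_mod_cast hn
    have := meanGroundState_le hn hp hs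
    simp only
    rw [neg_div, mul_div_cancel_left₀ _ hn'.ne']
    linarith
  have h := (hsub.tendsto_lim hbdd).neg
  refine tendsto_nhds_limUnder ⟨_, h.congr' ?_⟩
  filter_upwards [eventually_gt_atTop 0] with n hn
  have hn' : (0 : ℝ) < n := by exact_mod_cast hn
  rw [neg_div, neg_neg, mul_div_cancel_left₀ _ hn'.ne']

end MeanLimit

/-! ### Summable fourth moments. -/

section AlmostSure

variable {p : ℝ}

lemma lintegral_unitGroundState_sub_mean_pow_four_le {n : ℕ} (hn : 0 < n) (hp : 0 < p) (s : ℝ) :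
    ∫⁻ w, ENNReal.ofReal ((unitGroundState p s n w - meanGroundState p s n) ^ 4) ∂(stdGaussian _)
      ≤ ENNReal.ofReal ((Real.pi / 2) ^ 4) *
        (ENNReal.ofReal (1 / (n : ℝ) ^ 2) * gaussianFourthMoment) := by
  have h := lintegral_supAffine_sub_integral_pow_four_le (norm_energyCoeff_sphereSeq_le hn)
    (abs_energyDrift_sphereSeq_le hn hp s)
  refine h.trans (le_of_eq ?_)
  have : (√(n : ℝ))⁻¹ ^ 4 = 1 / (n : ℝ) ^ 2 := by
    rw [inv_pow, show 4 = 2 * 2 by norm_num, pow_mul, Real.sq_sqrt (Nat.cast_nonneg n), one_div]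
  rw [this]

/-- Random variables with summable fourth moments converge to zero almost surely. -/
lemma ae_tendsto_zero_of_tsum_lintegral_pow_four {Ω : Type*} [MeasurableSpace Ω] {P : Measure Ω}
    {X : ℕ → Ω → ℝ} (hX : ∀ n, AEMeasurable (X n) P)
    (hsum : ∑' n, ∫⁻ ω, ENNReal.ofReal (X n ω ^ 4) ∂P ≠ ⊤) :
    ∀ᵐ ω ∂P, Tendsto (fun n => X n ω) atTop (𝓝 0) := by
  have hm : ∀ n, AEMeasurable (fun ω => ENNReal.ofReal (X n ω ^ 4)) P := fun n =>
    ((hX n).pow_const 4).ennreal_ofReal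
  rw [← lintegral_tsum hm] at hsum
  filter_upwards [ae_lt_top' (AEMeasurable.tsum hm) hsum] with ω hω
  have h1 := ENNReal.tendsto_atTop_zero_of_tsum_ne_top hω.ne
  have h2 := (ENNReal.tendsto_toReal ENNReal.zero_ne_top).comp h1
  have h3 : Tendsto (fun n => X n ω ^ 4) atTop (𝓝 0) := by
    refine h2.congr fun n => ?_
    exact ENNReal.toReal_ofReal (Even.pow_nonneg (by decide) _)
  have h4 : Tendsto (fun n => √(√(X n ω ^ 4))) atTop (𝓝 0) := by
    simpa using h3.sqrt.sqrt
  refine (tendsto_zero_iff_abs_tendsto_zero _).2 (h4.congr fun n => ?_)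
  rw [show X n ω ^ 4 = (X n ω ^ 2) ^ 2 by ring, Real.sqrt_sq (sq_nonneg _), Real.sqrt_sq_eq_abs]
  rfl

end AlmostSure

/-! ### Deterministic properties: scaling, monotonicity, convexity. -/

section Deterministic

variable {n : ℕ} {p : ℝ}

lemma penalizedEnergy_smul_sqrt (hp : 0 < p) {u : ℝ} (hu : 0 < u) (t : ℝ)
    (A : Matrix (Fin n) (Fin n) ℝ) (x : Fin n → ℝ) :
    penalizedEnergy p t A (√u • x) = u * penalizedEnergy p (t * u ^ (p / 2 - 1)) A x := by
  have h1 : ∀ i, |(√u • x) i| ^ p = u ^ (p / 2) * |x i| ^ p := fun i => by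
    rw [Pi.smul_apply, smul_eq_mul, abs_mul, abs_of_nonneg (Real.sqrt_nonneg u),
      Real.mul_rpow (Real.sqrt_nonneg u) (abs_nonneg _), Real.sqrt_eq_rpow, ← Real.rpow_mul hu.le]
    ring_nf
  have h2 : u ^ (p / 2) = u * u ^ (p / 2 - 1) := by
    rw [Real.rpow_sub_one hu.ne']
    field_simp
  have h3 : √u * √u = u := Real.mul_self_sqrt hu.le
  simp only [penalizedEnergy, normalizedNorm_rpow hp, h1, ← Finset.mul_sum, Matrix.mulVec_smul,
    smul_dotProduct, dotProduct_smul, smul_eq_mul, h2]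
  rw [← mul_assoc √u, h3]
  ring

-- The quadratic term scales by u and the penalty by u^{p/2} = u · u^{p/2-1}, so the overlap can be
-- absorbed into the penalty parameter.
open scoped Pointwise in
lemma constrainedGroundStateEnergy_eq_mul (hp : 0 < p) {u : ℝ} (hu : 0 < u) (t : ℝ)
    (A : Matrix (Fin n) (Fin n) ℝ) : constrainedGroundStateEnergy p u t A
      = u * constrainedGroundStateEnergy p 1 (t * u ^ (p / 2 - 1)) A := by
  have hnorm : ∀ x : Fin n → ℝ, normalizedNorm 2 (√u • x) ^ 2 = u * normalizedNorm 2 x ^ 2 := by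
    intro x
    simp only [normalizedNorm_two_sq, Pi.smul_apply, smul_eq_mul, mul_pow, Real.sq_sqrt hu.le,
      ← Finset.mul_sum]
    ring
  have hs : √u ≠ 0 := (Real.sqrt_pos.2 hu).ne'
  have himage : penalizedEnergy p t A '' {x | normalizedNorm 2 x ^ 2 = u}
      = u • (penalizedEnergy p (t * u ^ (p / 2 - 1)) A '' {x | normalizedNorm 2 x ^ 2 = 1}) := by
    ext r
    rw [Set.mem_smul_set]
    constructor
    · rintro ⟨x, hx, rfl⟩
      have hx' : √u • ((√u)⁻¹ • x) = x := smul_inv_smul₀ hs x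
      refine ⟨_, ⟨(√u)⁻¹ • x, ?_, rfl⟩, ?_⟩
      · have := hnorm ((√u)⁻¹ • x)
        rw [hx', Set.mem_ofPred_eq.mp hx] at this
        exact mul_left_cancel₀ hu.ne' (by rw [← this, mul_one])
      · rw [smul_eq_mul, ← penalizedEnergy_smul_sqrt hp hu, hx']
    · rintro ⟨_, ⟨x, hx, rfl⟩, rfl⟩
      refine ⟨√u • x, ?_, penalizedEnergy_smul_sqrt hp hu t A x⟩
      rw [Set.mem_ofPred_eq, hnorm, Set.mem_ofPred_eq.mp hx, mul_one]
  rw [constrainedGroundStateEnergy, himage, Real.sSup_smul_of_nonneg hu.le, smul_eq_mul]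
  rfl

lemma one_le_normalizedNorm_rpow (hn : 0 < n) (hp : 2 < p) {x : Fin n → ℝ}
    (hx : normalizedNorm 2 x ^ 2 = 1) : 1 ≤ normalizedNorm p x ^ p := by
  have hn' : (0 : ℝ) < n := by exact_mod_cast hn
  rw [normalizedNorm_two_sq, one_div, ← div_eq_inv_mul, div_eq_one_iff_eq hn'.ne'] at hx
  rw [normalizedNorm_rpow (by linarith), one_div, ← div_eq_inv_mul, le_div_iff₀ hn', one_mul]
  -- Bernoulli's inequality at x_i² - 1; on the sphere the linear terms sum to zero.
  have h1 : ∀ i, 1 + p / 2 * (x i ^ 2 - 1) ≤ |x i| ^ p := fun i => by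
    have := one_add_mul_self_le_rpow_one_add (s := x i ^ 2 - 1) (by linarith [sq_nonneg (x i)])
      (p := p / 2) (by linarith)
    refine this.trans (le_of_eq ?_)
    rw [add_sub_cancel, ← sq_abs, ← Real.rpow_natCast, ← Real.rpow_mul (abs_nonneg _)]
    congr 1
    push_cast
    ring
  refine le_trans (le_of_eq ?_) (Finset.sum_le_sum fun i _ => h1 i)
  rw [Finset.sum_add_distrib, ← Finset.mul_sum, Finset.sum_sub_distrib, hx]
  simp

lemma constrainedGroundStateEnergy_antitone (hn : 0 < n) (hp : 2 < p)
    (A : Matrix (Fin n) (Fin n) ℝ) :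
    Antitone fun s => constrainedGroundStateEnergy p 1 s A := by
  intro s s' hss
  obtain ⟨x, hx, he⟩ := (isGreatest_constrainedGroundStateEnergy hn hp one_pos s' A).1
  refine he.symm.le.trans (le_trans ?_
    ((isGreatest_constrainedGroundStateEnergy hn hp one_pos s A).2 ⟨x, hx, rfl⟩))
  have := one_le_normalizedNorm_rpow hn hp hx
  simp only [penalizedEnergy]
  gcongr

lemma constrainedGroundStateEnergy_le_sub (hn : 0 < n) (hp : 2 < p) {s : ℝ} (hs : 0 ≤ s)
    (A : Matrix (Fin n) (Fin n) ℝ) : constrainedGroundStateEnergy p 1 s A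
      ≤ constrainedGroundStateEnergy p 1 0 A - s := by
  obtain ⟨x, hx, he⟩ := (isGreatest_constrainedGroundStateEnergy hn hp one_pos s A).1
  have h0 := (isGreatest_constrainedGroundStateEnergy hn hp one_pos 0 A).2 ⟨x, hx, rfl⟩
  have := mul_le_mul_of_nonneg_left (one_le_normalizedNorm_rpow hn hp hx) hs
  rw [← he]
  simp only [penalizedEnergy] at h0 ⊢
  linarith

/-- For fixed x the energy is affine in s, and a maximum of affine functions is convex. -/
lemma constrainedGroundStateEnergy_convexOn (hn : 0 < n) (hp : 2 < p)
    (A : Matrix (Fin n) (Fin n) ℝ) :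
    ConvexOn ℝ Set.univ fun s => constrainedGroundStateEnergy p 1 s A := by
  refine ⟨convex_univ, fun s _ s' _ a b ha hb hab => ?_⟩
  obtain ⟨x, hx, he⟩ :=
    (isGreatest_constrainedGroundStateEnergy hn hp one_pos (a • s + b • s') A).1
  have h1 := mul_le_mul_of_nonneg_left
    ((isGreatest_constrainedGroundStateEnergy hn hp one_pos s A).2 ⟨x, hx, rfl⟩) ha
  have h2 := mul_le_mul_of_nonneg_left
    ((isGreatest_constrainedGroundStateEnergy hn hp one_pos s' A).2 ⟨x, hx, rfl⟩) hb
  refine he.symm.le.trans ?_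
  simp only [penalizedEnergy, smul_eq_mul] at h1 h2 ⊢
  have hb' : b = 1 - a := by linarith
  subst hb'
  linarith

lemma constrainedGroundStateEnergy_le_groundStateEnergy (hn : 0 < n) (hp : 2 < p) {u t : ℝ}
    (hu : 0 < u) (ht : 0 < t) (A : Matrix (Fin n) (Fin n) ℝ) :
    constrainedGroundStateEnergy p u t A ≤ groundStateEnergy p t A := by
  obtain ⟨x, -, he⟩ := (isGreatest_constrainedGroundStateEnergy hn hp hu t A).1
  rw [← he]
  exact (isGreatest_groundStateEnergy hn hp ht A).2 ⟨x, rfl⟩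

lemma groundStateEnergy_nonpos_or_eq (hn : 0 < n) (hp : 2 < p) {t : ℝ} (ht : 0 < t)
    (A : Matrix (Fin n) (Fin n) ℝ) : groundStateEnergy p t A ≤ 0 ∨
      ∃ u, 0 < u ∧ groundStateEnergy p t A = constrainedGroundStateEnergy p u t A := by
  have hn' : (0 : ℝ) < n := by exact_mod_cast hn
  obtain ⟨x, he⟩ := (isGreatest_groundStateEnergy hn hp ht A).1
  have hx0 : 0 ≤ normalizedNorm 2 x ^ 2 := sq_nonneg _
  rcases hx0.eq_or_lt with hx | hx
  · left
    rw [normalizedNorm_two_sq, eq_comm, mul_eq_zero, or_iff_right (by positivity),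
      Finset.sum_eq_zero_iff_of_nonneg fun i _ => sq_nonneg _] at hx
    have hx' : x = 0 := funext fun i => by simpa using hx i (Finset.mem_univ i)
    have hp0 : 0 < p := by linarith
    rw [← he, hx']
    simp [penalizedEnergy, normalizedNorm_rpow hp0, Real.zero_rpow hp0.ne']
  · right
    refine ⟨_, hx, le_antisymm ?_ (constrainedGroundStateEnergy_le_groundStateEnergy hn hp hx ht A)⟩
    rw [← he]
    exact (isGreatest_constrainedGroundStateEnergy hn hp hx t A).2 ⟨x, rfl, rfl⟩

end Deterministic

/-! ### The limit functions and the unconstrained maximum. -/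

section Limit

variable {p : ℝ}

lemma unitGroundState_eq_constrained {n : ℕ} (hn : 0 < n) (hp : 2 < p) (s : ℝ)
    (w : EuclideanSpace ℝ (Fin n × Fin n)) : unitGroundState p s n w
      = constrainedGroundStateEnergy p 1 s (Matrix.of fun i j => w (i, j)) := by
  have hw : matrixVec (Matrix.of fun i j => w (i, j)) = w := rfl
  rw [constrainedGroundStateEnergy_one_eq hn hp, hw]

lemma limitGroundState_antitoneOn (hp : 2 < p) :
    AntitoneOn (limitGroundState p) (Set.Ici 0) := by
  intro s hs s' hs' hss
  refine le_of_tendsto_of_tendsto (tendsto_meanGroundState hp hs') (tendsto_meanGroundState hp hs) ?_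
  filter_upwards [eventually_gt_atTop 0] with n hn
  refine integral_mono (integrable_unitGroundState hn (by linarith) _)
    (integrable_unitGroundState hn (by linarith) _) fun w => ?_
  rw [unitGroundState_eq_constrained hn hp, unitGroundState_eq_constrained hn hp]
  exact constrainedGroundStateEnergy_antitone hn hp _ hss

lemma limitGroundState_le_sub (hp : 2 < p) {s : ℝ} (hs : 0 ≤ s) :
    limitGroundState p s ≤ limitGroundState p 0 - s := by
  refine le_of_tendsto_of_tendsto (tendsto_meanGroundState hp hs)
    ((tendsto_meanGroundState hp le_rfl).sub_const s) ?_
  filter_upwards [eventually_gt_atTop 0] with n hn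
  have hi := integrable_unitGroundState hn (show 0 < p by linarith)
  have : meanGroundState p 0 n - s
      = ∫ w, (unitGroundState p 0 n w - s) ∂(stdGaussian (EuclideanSpace ℝ (Fin n × Fin n))) := by
    rw [integral_sub (hi 0) (integrable_const _)]
    simp [meanGroundState]
  rw [this]
  refine integral_mono (hi s) ((hi 0).sub (integrable_const _)) fun w => ?_
  simp only [unitGroundState_eq_constrained hn hp]
  exact constrainedGroundStateEnergy_le_sub hn hp hs _

/-- Wanted for the continuity it gives on the open half-line, through which convergence at rationals
spreads to all positive arguments. -/
lemma limitGroundState_convexOn (hp : 2 < p) :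
    ConvexOn ℝ (Set.Ioi 0) (limitGroundState p) := by
  refine ⟨convex_Ioi 0, fun s hs s' hs' a b ha hb hab => ?_⟩
  have hs'' : (0 : ℝ) < a • s + b • s' := convex_Ioi (0 : ℝ) hs hs' ha hb hab
  refine le_of_tendsto_of_tendsto (tendsto_meanGroundState hp hs''.le)
    (((tendsto_meanGroundState hp (le_of_lt hs)).const_smul a).add
      ((tendsto_meanGroundState hp (le_of_lt hs')).const_smul b)) ?_
  filter_upwards [eventually_gt_atTop 0] with n hn
  have hi := integrable_unitGroundState hn (show 0 < p by linarith)
  simp only [meanGroundState, smul_eq_mul]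
  rw [← integral_const_mul, ← integral_const_mul,
    ← integral_add ((hi _).const_mul _) ((hi _).const_mul _)]
  refine integral_mono (hi _) (((hi _).const_mul _).add ((hi _).const_mul _)) fun w => ?_
  simp only [unitGroundState_eq_constrained hn hp]
  exact (constrainedGroundStateEnergy_convexOn hn hp _).2 trivial trivial ha hb hab

/-- Pointwise convergence of antitone functions on the nonnegative rationals extends to
continuity points of the limit. -/
lemma tendsto_of_antitone_of_rat {f : ℕ → ℝ → ℝ} {g : ℝ → ℝ} (hf : ∀ᶠ n in atTop, Antitone (f n))
    (hlim : ∀ q : ℚ, 0 ≤ q → Tendsto (fun n => f n q) atTop (𝓝 (g q))) {s : ℝ} (hs : 0 < s)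
    (hg : ContinuousAt g s) : Tendsto (fun n => f n s) atTop (𝓝 (g s)) := by
  rw [tendsto_order]
  constructor
  · intro r hr
    obtain ⟨δ, hδ, h⟩ := Metric.mem_nhds_iff.1 (hg.eventually_const_lt hr)
    obtain ⟨q, hq1, hq2⟩ := exists_rat_btwn (show s < s + δ by linarith)
    have hq : r < g q := h (by
      rw [Metric.mem_ball, Real.dist_eq, abs_of_pos (by linarith)]; linarith)
    have hq0 : (0 : ℚ) ≤ q := by exact_mod_cast (hs.trans hq1).le
    filter_upwards [hf, (hlim q hq0).eventually_const_lt hq] with n hn1 hn2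
    exact hn2.trans_le (hn1 hq1.le)
  · intro r hr
    obtain ⟨δ, hδ, h⟩ := Metric.mem_nhds_iff.1 (hg.eventually_lt_const hr)
    obtain ⟨q, hq1, hq2⟩ := exists_rat_btwn (show max 0 (s - δ) < s by
      rw [max_lt_iff]; constructor <;> linarith)
    rw [max_lt_iff] at hq1
    have hq : g q < r := h (by
      rw [Metric.mem_ball, Real.dist_eq, abs_of_neg (by linarith)]; linarith)
    have hq0 : (0 : ℚ) ≤ q := by exact_mod_cast hq1.1.le
    filter_upwards [hf, (hlim q hq0).eventually_lt_const hq] with n hn1 hn2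
    exact (hn1 hq2.le).trans_lt hn2

/-- The limit of `E L_{n,p,u}(t)`. -/
noncomputable def limitConstrained (p u t : ℝ) : ℝ :=
  u * limitGroundState p (t * u ^ (p / 2 - 1))

/-- The limit of `L_{n,p}(t)`. -/
noncomputable def limitUnconstrained (p t : ℝ) : ℝ :=
  sSup ((fun u => limitConstrained p u t) '' Set.Ioi 0)

lemma exists_cutoff (hp : 2 < p) {t : ℝ} (ht : 0 < t) (K : ℝ) :
    ∃ U : ℝ, 0 < U ∧ ∀ u, U ≤ u → K ≤ t * u ^ (p / 2 - 1) := by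
  have h := (tendsto_rpow_atTop (show 0 < p / 2 - 1 by linarith)).const_mul_atTop ht
  obtain ⟨U, hU⟩ := ((h.eventually_ge_atTop K).and (eventually_gt_atTop 0)).exists_forall_of_atTop
  exact ⟨U, (hU U le_rfl).2, fun u hu => (hU u hu).1⟩

lemma mul_rpow_nonneg {t u : ℝ} (ht : 0 < t) (hu : 0 ≤ u) : 0 ≤ t * u ^ (p / 2 - 1) := by
  positivity

lemma bddAbove_limitConstrained (hp : 2 < p) {t : ℝ} (ht : 0 < t) :
    BddAbove ((fun u => limitConstrained p u t) '' Set.Ioi 0) := by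
  obtain ⟨U, hU, h⟩ := exists_cutoff hp ht (limitGroundState p 0)
  refine ⟨U * |limitGroundState p 0|, ?_⟩
  rintro _ ⟨u, hu, rfl⟩
  have hu' : (0 : ℝ) < u := hu
  have h1 := limitGroundState_le_sub hp (mul_rpow_nonneg (p := p) ht hu'.le)
  have h3 := mul_rpow_nonneg (p := p) ht hu'.le
  simp only [limitConstrained]
  rcases le_total U u with hUu | hUu
  · have h2 := h u hUu
    have : u * limitGroundState p (t * u ^ (p / 2 - 1)) ≤ 0 :=
      mul_nonpos_of_nonneg_of_nonpos hu'.le (by linarith)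
    exact this.trans (by positivity)
  · calc u * limitGroundState p (t * u ^ (p / 2 - 1)) ≤ u * |limitGroundState p 0| := by
          refine mul_le_mul_of_nonneg_left ?_ hu'.le
          linarith [le_abs_self (limitGroundState p 0)]
      _ ≤ _ := by gcongr

lemma isLUB_limitUnconstrained (hp : 2 < p) {t : ℝ} (ht : 0 < t) :
    IsLUB ((fun u => limitConstrained p u t) '' Set.Ioi 0) (limitUnconstrained p t) :=
  isLUB_csSup (Set.nonempty_Ioi.image _) (bddAbove_limitConstrained hp ht)

/-- For u ≤ 1 antitonicity gives a lower bound u · `limitGroundState p t`, which tends to 0 with u.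
-/
lemma limitUnconstrained_nonneg (hp : 2 < p) {t : ℝ} (ht : 0 < t) :
    0 ≤ limitUnconstrained p t := by
  have hα : 0 ≤ p / 2 - 1 := by linarith
  have h1 : ∀ u ∈ Set.Ioc (0 : ℝ) 1, u * limitGroundState p t ≤ limitUnconstrained p t := by
    intro u hu
    refine le_trans ?_ ((isLUB_limitUnconstrained hp ht).1 ⟨u, hu.1, rfl⟩)
    refine mul_le_mul_of_nonneg_left (limitGroundState_antitoneOn hp
      (mul_rpow_nonneg ht hu.1.le) ht.le ?_) hu.1.le
    exact mul_le_of_le_one_right ht.le (Real.rpow_le_one hu.1.le hu.2 hα)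
  have h2 : Tendsto (fun u : ℝ => u * limitGroundState p t) (𝓝[>] 0) (𝓝 0) := by
    have : Tendsto (fun u : ℝ => u * limitGroundState p t) (𝓝 0) (𝓝 (0 * limitGroundState p t)) :=
      tendsto_id.mul_const _
    rw [zero_mul] at this
    exact this.mono_left nhdsWithin_le_nhds
  exact le_of_tendsto h2 (Filter.mem_of_superset (Ioc_mem_nhdsGT one_pos) h1)

/-- Convergence of the constrained energies on the unit sphere implies convergence of the
unconstrained ones. -/
lemma tendsto_groundStateEnergy (hp : 2 < p) {A : (n : ℕ) → Matrix (Fin n) (Fin n) ℝ}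
    (hA : ∀ s, 0 ≤ s → Tendsto (fun n => constrainedGroundStateEnergy p 1 s (A n)) atTop
      (𝓝 (limitGroundState p s))) {t : ℝ} (ht : 0 < t) :
    Tendsto (fun n => groundStateEnergy p t (A n)) atTop (𝓝 (limitUnconstrained p t)) := by
  have hp0 : 0 < p := by linarith
  have hα : 0 < p / 2 - 1 := by linarith
  rw [tendsto_order]
  constructor
  · intro r hr
    obtain ⟨_, ⟨u, hu, rfl⟩, hru⟩ := exists_lt_of_lt_csSup (Set.nonempty_Ioi.image _) hr
    have hu' : (0 : ℝ) < u := hu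
    have hlim : Tendsto (fun n => constrainedGroundStateEnergy p u t (A n)) atTop
        (𝓝 (limitConstrained p u t)) := by
      simp_rw [constrainedGroundStateEnergy_eq_mul hp0 hu' t]
      exact (hA _ (mul_rpow_nonneg ht hu'.le)).const_mul u
    filter_upwards [hlim.eventually_const_lt hru, eventually_gt_atTop 0] with n hn1 hn
    exact hn1.trans_le (constrainedGroundStateEnergy_le_groundStateEnergy hn hp hu' ht _)
  · intro r hr
    set L := limitUnconstrained p t with hL
    have hL0 : 0 ≤ L := limitUnconstrained_nonneg hp ht
    -- The extra 1 makes `K` positive and leaves room for the energies at s = 0 to be eventually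
    -- below it.
    set K := |limitGroundState p 0| + 1 with hK
    have hK0 : 0 < K := by positivity
    obtain ⟨U, hU, hcut⟩ := exists_cutoff hp ht K
    obtain ⟨δ, hδ, hδK⟩ : ∃ δ : ℝ, 0 < δ ∧ L + δ * K < r := by
      refine ⟨(r - L) / (2 * K), div_pos (by linarith) (by positivity), ?_⟩
      have : (r - L) / (2 * K) * K = (r - L) / 2 := by field_simp
      rw [this]
      linarith
    -- For u in the cell [iδ, (i+1)δ], this product bounds the constrained maximum: the right
    -- endpoint bounds the factor u and the left one the penalty. In the limit the mismatch costs at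
    -- most δK. The cell i = 0 needs convergence at s = 0.
    have hgrid : ∀ i : ℕ, ∀ᶠ n in atTop, ((i : ℝ) * δ + δ) *
        max (constrainedGroundStateEnergy p 1 (t * ((i : ℝ) * δ) ^ (p / 2 - 1)) (A n)) 0 < r := by
      intro i
      have hi : (0 : ℝ) ≤ i * δ := by positivity
      set s := t * ((i : ℝ) * δ) ^ (p / 2 - 1) with hs
      have hs0 : 0 ≤ s := mul_rpow_nonneg ht hi
      have hlim := ((hA s hs0).max (tendsto_const_nhds (x := (0 : ℝ)))).const_mul ((i : ℝ) * δ + δ)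
      refine hlim.eventually_lt_const (lt_of_le_of_lt ?_ hδK)
      rw [add_mul]
      refine add_le_add ?_ (mul_le_mul_of_nonneg_left ?_ hδ.le)
      · rcases hi.eq_or_lt with h0 | h0
        · rw [← h0, zero_mul]; exact hL0
        · rw [mul_max_of_nonneg _ _ hi, mul_zero]
          exact max_le ((isLUB_limitUnconstrained hp ht).1 ⟨_, h0, rfl⟩) hL0
      · refine max_le ?_ hK0.le
        have := limitGroundState_le_sub hp hs0
        linarith [le_abs_self (limitGroundState p 0)]
    have hfin : ∀ᶠ n in atTop, ∀ i ∈ Finset.range (⌊U / δ⌋₊ + 1), ((i : ℝ) * δ + δ) *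
        max (constrainedGroundStateEnergy p 1 (t * ((i : ℝ) * δ) ^ (p / 2 - 1)) (A n)) 0 < r :=
      (Finset.eventually_all _).2 fun i _ => hgrid i
    have hzero : ∀ᶠ n in atTop, constrainedGroundStateEnergy p 1 0 (A n) < K :=
      (hA 0 le_rfl).eventually_lt_const (by linarith [le_abs_self (limitGroundState p 0)])
    filter_upwards [hfin, hzero, eventually_gt_atTop 0] with n hn1 hn2 hn
    rcases groundStateEnergy_nonpos_or_eq hn hp ht (A n) with h | ⟨v, hv, he⟩
    · linarith
    rw [he, constrainedGroundStateEnergy_eq_mul hp0 hv]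
    -- Beyond the cutoff the penalty exceeds the maximum at s = 0, so the value is nonpositive;
    -- below it `v` falls in one of finitely many cells.
    rcases le_total U v with hUv | hUv
    · have h1 := constrainedGroundStateEnergy_le_sub hn hp (mul_rpow_nonneg (p := p) ht hv.le) (A n)
      have h2 := hcut v hUv
      have h3 := mul_nonpos_of_nonneg_of_nonpos hv.le (show constrainedGroundStateEnergy p 1
        (t * v ^ (p / 2 - 1)) (A n) ≤ 0 by linarith)
      linarith
    · have hvi := Nat.floor_le (div_nonneg hv.le hδ.le)
      have hvi' := (Nat.lt_floor_add_one (v / δ)).le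
      rw [le_div_iff₀ hδ] at hvi
      rw [div_le_iff₀ hδ, add_mul, one_mul] at hvi'
      have hmem : ⌊v / δ⌋₊ ∈ Finset.range (⌊U / δ⌋₊ + 1) := by
        rw [Finset.mem_range, Nat.lt_succ_iff]
        gcongr
      refine lt_of_le_of_lt ?_ (hn1 _ hmem)
      refine (mul_le_mul_of_nonneg_left (le_max_of_le_left ?_) hv.le).trans
        (mul_le_mul_of_nonneg_right hvi' (le_max_right _ _))
      refine constrainedGroundStateEnergy_antitone hn hp _ ?_
      gcongr

end Limit

/-! ### Transfer to the random matrices and conclusion. -/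

section Main

variable {p : ℝ} {Ω : Type*} [MeasurableSpace Ω] {P : Measure Ω}

lemma IsGaussianMatrix.hasLaw_matrixVec [IsProbabilityMeasure P] {n : ℕ}
    {G : Ω → Matrix (Fin n) (Fin n) ℝ} (hG : IsGaussianMatrix P G) :
    HasLaw (fun ω => matrixVec (G ω)) (stdGaussian (EuclideanSpace ℝ (Fin n × Fin n))) P := by
  have hm : ∀ ij : Fin n × Fin n, AEMeasurable (fun ω => G ω ij.1 ij.2) P := fun ij =>
    (hG.law ij.1 ij.2).aemeasurable
  have hm' : AEMeasurable (fun ω => fun ij : Fin n × Fin n => G ω ij.1 ij.2) P :=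
    aemeasurable_pi_lambda _ hm
  have hlaw := (iIndepFun_iff_map_fun_eq_pi_map hm).1 hG.indep
  simp_rw [(hG.law _ _).map_eq] at hlaw
  have hL : Measurable (WithLp.toLp 2 : (Fin n × Fin n → ℝ) → EuclideanSpace ℝ (Fin n × Fin n)) := by
    fun_prop
  refine ⟨hL.comp_aemeasurable hm', ?_⟩
  rw [← map_pi_eq_stdGaussian, ← hlaw, AEMeasurable.map_map_of_aemeasurable hL.aemeasurable hm']
  rfl

lemma IsGaussianMatrix.integrable_constrained [IsProbabilityMeasure P] {n : ℕ} (hn : 0 < n)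
    (hp : 2 < p) {G : Ω → Matrix (Fin n) (Fin n) ℝ} (hG : IsGaussianMatrix P G) (s : ℝ) :
    Integrable (fun ω => constrainedGroundStateEnergy p 1 s (G ω)) P := by
  simp_rw [constrainedGroundStateEnergy_one_eq hn hp]
  have h := integrable_unitGroundState hn (show 0 < p by linarith) s
  rw [← hG.hasLaw_matrixVec.map_eq] at h
  exact h.comp_aemeasurable hG.hasLaw_matrixVec.aemeasurable

lemma IsGaussianMatrix.integral_constrained [IsProbabilityMeasure P] {n : ℕ} (hn : 0 < n)
    (hp : 2 < p) {G : Ω → Matrix (Fin n) (Fin n) ℝ} (hG : IsGaussianMatrix P G) (s : ℝ) :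
    ∫ ω, constrainedGroundStateEnergy p 1 s (G ω) ∂P = meanGroundState p s n := by
  simp_rw [constrainedGroundStateEnergy_one_eq hn hp]
  rw [meanGroundState, ← hG.hasLaw_matrixVec.map_eq,
    integral_map hG.hasLaw_matrixVec.aemeasurable
      (measurable_unitGroundState _ _ _).aestronglyMeasurable]

lemma ae_tendsto_constrainedGroundStateEnergy [IsProbabilityMeasure P] (hp : 2 < p)
    {G : (n : ℕ) → Ω → Matrix (Fin n) (Fin n) ℝ} (hG : ∀ n, IsGaussianMatrix P (G n)) {s : ℝ}
    (hs : 0 ≤ s) : ∀ᵐ ω ∂P, Tendsto (fun n => constrainedGroundStateEnergy p 1 s (G n ω)) atTop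
      (𝓝 (limitGroundState p s)) := by
  have hp0 : 0 < p := by linarith
  -- The shift avoids n = 0, where the bound of order n^{-2} is not available.
  let X : ℕ → Ω → ℝ := fun n ω =>
    constrainedGroundStateEnergy p 1 s (G (n + 1) ω) - meanGroundState p s (n + 1)
  have hX : ∀ n, X n = fun ω => unitGroundState p s (n + 1) (matrixVec (G (n + 1) ω))
      - meanGroundState p s (n + 1) := fun n => funext fun ω => by
    simp only [X]
    rw [constrainedGroundStateEnergy_one_eq n.succ_pos hp]
  have hmeas : ∀ n, AEMeasurable (X n) P := fun n =>
    ((hG (n + 1)).integrable_constrained n.succ_pos hp s).aemeasurable.sub_const _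
  have hbound : ∀ n, ∫⁻ ω, ENNReal.ofReal (X n ω ^ 4) ∂P ≤ ENNReal.ofReal ((Real.pi / 2) ^ 4) *
      (ENNReal.ofReal (1 / ((n + 1 : ℕ) : ℝ) ^ 2) * gaussianFourthMoment) := by
    intro n
    refine le_trans (le_of_eq ?_)
      (lintegral_unitGroundState_sub_mean_pow_four_le n.succ_pos hp0 s)
    have hmp := (hG (n + 1)).hasLaw_matrixVec
    rw [← hmp.map_eq, lintegral_map' _ hmp.aemeasurable, hX]
    exact ((((measurable_unitGroundState p s (n + 1)).sub_const _).pow_const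
      4).ennreal_ofReal).aemeasurable
  have hsum : ∑' n, ∫⁻ ω, ENNReal.ofReal (X n ω ^ 4) ∂P ≠ ⊤ := by
    refine ne_top_of_le_ne_top ?_ (ENNReal.tsum_le_tsum hbound)
    rw [ENNReal.tsum_mul_left, ENNReal.tsum_mul_right]
    refine ENNReal.mul_ne_top ENNReal.ofReal_ne_top
      (ENNReal.mul_ne_top ?_ gaussianFourthMoment_ne_top)
    have := (summable_nat_add_iff 1).2 (Real.summable_one_div_nat_pow.2 (by norm_num : 1 < 2))
    exact this.tsum_ofReal_ne_top
  filter_upwards [ae_tendsto_zero_of_tsum_lintegral_pow_four hmeas hsum] with ω hω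
  rw [← tendsto_add_atTop_iff_nat 1]
  have h1 := hω.add ((tendsto_add_atTop_iff_nat 1).2 (tendsto_meanGroundState hp hs))
  rw [zero_add] at h1
  exact h1.congr fun n => by simp [X]

end Main

theorem theorem1p4 (p : ℝ) (hp : 2 < p) :
    ∃ (Lpu : ℝ → ℝ → ℝ) (Lp : ℝ → ℝ),
      (∀ t : ℝ, 0 < t → IsLUB ((fun u => Lpu u t) '' Set.Ioi 0) (Lp t)) ∧
      ∀ (Ω : Type*) [MeasurableSpace Ω] (P : Measure Ω) [IsProbabilityMeasure P]
        (G : (n : ℕ) → Ω → Matrix (Fin n) (Fin n) ℝ),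
        (∀ n, IsGaussianMatrix P (G n)) →
        (∀ u t : ℝ, 0 < u → 0 < t →
          (∀ n, Integrable (fun ω => constrainedGroundStateEnergy p u t (G n ω)) P) ∧
          Tendsto (fun n => ∫ ω, constrainedGroundStateEnergy p u t (G n ω) ∂P)
            atTop (𝓝 (Lpu u t))) ∧
        ∀ᵐ ω ∂P,
          (∀ u t : ℝ, 0 < u → 0 < t →
            Tendsto (fun n => constrainedGroundStateEnergy p u t (G n ω))
              atTop (𝓝 (Lpu u t))) ∧
          (∀ t : ℝ, 0 < t →
            Tendsto (fun n => groundStateEnergy p t (G n ω)) atTop (𝓝 (Lp t))) := by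
  have hp0 : 0 < p := by linarith
  refine ⟨limitConstrained p, limitUnconstrained p,
    fun t ht => isLUB_limitUnconstrained hp ht, ?_⟩
  intro Ω _ P _ G hG
  refine ⟨fun u t hu ht => ⟨fun n => ?_, ?_⟩, ?_⟩
  · simp_rw [constrainedGroundStateEnergy_eq_mul hp0 hu t]
    refine Integrable.const_mul ?_ _
    rcases Nat.eq_zero_or_pos n with rfl | hn
    · have h0 : ∀ ω, G 0 ω = 0 := fun ω => Matrix.ext fun i => i.elim0
      simp_rw [h0]
      exact integrable_const _
    · exact (hG n).integrable_constrained hn hp _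
  · simp_rw [constrainedGroundStateEnergy_eq_mul hp0 hu t, integral_const_mul]
    refine ((tendsto_meanGroundState hp (mul_rpow_nonneg ht hu.le)).congr' ?_).const_mul u
    filter_upwards [eventually_gt_atTop 0] with n hn
    exact ((hG n).integral_constrained hn hp _).symm
  · have hrat : ∀ᵐ ω ∂P, ∀ q : ℚ, 0 ≤ q → Tendsto
        (fun n => constrainedGroundStateEnergy p 1 (q : ℝ) (G n ω)) atTop
        (𝓝 (limitGroundState p q)) :=
      ae_all_iff.2 fun q => by
        by_cases hq : 0 ≤ q
        · filter_upwards [ae_tendsto_constrainedGroundStateEnergy hp hG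
            (show (0 : ℝ) ≤ q by exact_mod_cast hq)] with ω hω _ using hω
        · exact Eventually.of_forall fun ω h => absurd h hq
    filter_upwards [hrat] with ω hω
    have hall : ∀ s, 0 ≤ s → Tendsto (fun n => constrainedGroundStateEnergy p 1 s (G n ω)) atTop
        (𝓝 (limitGroundState p s)) := by
      intro s hs
      -- Continuity of the limit is known only for s > 0, so s = 0 is taken directly from the
      -- rational arguments.
      rcases hs.eq_or_lt with rfl | hs
      · simpa using hω 0 le_rfl
      · refine tendsto_of_antitone_of_rat
          (f := fun n s => constrainedGroundStateEnergy p 1 s (G n ω)) ?_ hω hs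
          (((limitGroundState_convexOn hp).continuousOn isOpen_Ioi).continuousAt
            (isOpen_Ioi.mem_nhds hs))
        filter_upwards [eventually_gt_atTop 0] with n hn
        exact constrainedGroundStateEnergy_antitone hn hp _
    refine ⟨fun u t hu ht => ?_, fun t ht => tendsto_groundStateEnergy hp hall ht⟩
    simp_rw [constrainedGroundStateEnergy_eq_mul hp0 hu t]
    exact (hall _ (mul_rpow_nonneg ht hu.le)).const_mul u
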